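/- **Setting.** Let $\mathfrak H$ be the upper half plane and let $\Gamma\subset PSL_2(\mathbb R)$ be a Fuchsian group of the first kind with at least two inequivalent cusps. (That is, $\Gamma$ is discrete and $\Gamma\backslash\mathfrak H^*$ is compact, where $\mathfrak H^*$ is the union of $\mathfrak H$ and the set of cusps of $\Gamma$, with the horocycle topology.) For each cusp $\mathfrak a$ let $\sigma_{\mathfrak a}\in SL_2(\mathbb R)$ be a scaling matrix: $\sigma_{\mathfrak a}\infty=\mathfrak a$ and $\sigma_{\mathfrak a}^{-1}\Gamma_{\mathfrak a}\sigma_{\mathfrak a}=\{\pm\left(\begin{smallmatrix}1&m\\0&1\end{smallmatrix}\right): m\in\mathbb Z\}$, where $\Gamma_{\mathfrak a}$ is the stabilizer of $\mathfrak a$ in $\Gamma$. Put $(f|_k\gamma)(z)=f(\gamma z)(cz+d)^{-k}$ for $\gamma=\left(\begin{smallmatrix}*&*\\c&d\end{smallmatrix}\right)$, and $f|_k(\gamma-1)=f|_k\gamma-f$. *Cusp forms of order $t$.* Let $S_k^0=\{0\}$. For $t\ge 1$ let $S_k^t$ be the space of holomorphic $f:\mathfrak H\to\mathbb C$ such that $f|_k(\gamma-1)\in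 S_k^{t-1}$ for all $\gamma\in\Gamma$, $f|_k\pi=f$ for all parabolic $\pi\in\Gamma$, and for each cusp $\mathfrak a$ there is $c>0$ with $(f|_k\sigma_{\mathfrak a})(z)\ll e^{-c\,\mathrm{Im}(z)}$ as $\mathrm{Im}(z)\to\infty$, uniformly in $\mathrm{Re}(z)$. *The spaces $\mathcal H_t$.* Let $\mathcal H_0=\mathcal H_1=\{0\}$. For $t>1$ let $\mathcal H_t$ be the space of maps from $\Gamma$ to functions on $\mathfrak H$ spanned by the maps $\gamma\mapsto\varphi(\gamma)h$ with $\varphi\in H_r$, $h\in S_2^s$, $r+s\le t$, $1\le r,s\le t-1$. Here $H_r$ is the complex vector space generated by the maps $\Gamma\to\mathbb C$ of the form $\gamma\mapsto\prod_{i=1}^m\big(\int_{z_i}^{\gamma z_i}f_i(w)\,dw\big)^{\pm}$, where $z_i\in\mathfrak H^*$, $f_i\in S_2^{r_i}$, the map $\gamma\mapsto f_i|_2(\gamma-1)$ lies in $\mathcal H_{r_i}$, $\sum_i r_i=r$, and the signs $\pm$ indicate, for each factor independently, absence or presence of complex conjugation. Integrals with an endpoint at a cusp are improper integrals along geodesics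 ending at the cusp. **Lemma 2.1.** Let $t\ge 0$ and let $f\in S_2^t$ be such that the map $\gamma\mapsto f|_2(\gamma-1)$ lies in $\mathcal H_t$. Then, for any cusp $\mathfrak a$ of $\Gamma$ and any $z_0\in\mathfrak H^*$, the integrals below converge, and for all $z\in\mathfrak H$ and all $\gamma\in\Gamma$ $$\text{(i)}\quad \mathrm{Im}(z)\,|f(z)|\ll\sum_{i=0}^{t-1}|\log(\mathrm{Im}(\sigma_{\mathfrak a}^{-1}z))|^i;\qquad\text{moreover, if } \infty \text{ is a cusp of }\Gamma,\quad \mathrm{Im}(z)\,|f(z)|\ll\sum_{i=0}^{t-1}|\log(\mathrm{Im}(z))|^i,$$ $$\text{(ii)}\quad \int_{z_0}^{z}f(w)\,dw\ll\sum_{j=0}^{t}|\log(\mathrm{Im}(\sigma_{\mathfrak a}^{-1}z))|^j,$$ $$\text{(iii)}\quad \int_{z_0}^{\gamma z_0}f(w)\,dw\ll\sum_{\substack{i+j\le t\\ 0\le i,j}}|\log(\mathrm{Im}(\sigma_{\mathfrak a}^{-1}z))|^i\,|\log(\mathrm{Im}(\sigma_{\mathfrak a}^{-1}\gamma z))|^j.$$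 The implied constants are independent of $z$ and $\gamma$. (An empty sum is $0$.) -/

import Mathlib

open UpperHalfPlane Filter Topology Matrix Matrix.GeneralLinearGroup
open scoped ModularForm MatrixGroups Manifold ComplexConjugate

noncomputable section

/-! ### The extended upper half plane and Fuchsian groups of the first kind

A subgroup of `PSL₂(ℝ)` is represented by a group `Γ` of real `2 × 2` matrices of determinant one
with that image (it may or may not contain `-1`). The cusps of `Γ` are the fixed points in
`ℝ ∪ {∞}` of its parabolic elements (`IsCusp`). -/

/-- The extended upper half plane `ℍ*`: the upper half plane together with the cusps of `Γ`. -/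
def ExtendedHalfPlane (Γ : Subgroup (GL (Fin 2) ℝ)) : Type :=
  ℍ ⊕ cuspsSubMulAction Γ

namespace ExtendedHalfPlane

/-- A point of `ℍ` as a point of `ℍ*`. -/
def ofPoint {Γ : Subgroup (GL (Fin 2) ℝ)} (z : ℍ) : ExtendedHalfPlane Γ := Sum.inl z

/-- A cusp as a point of `ℍ*`. -/
def ofCusp {Γ : Subgroup (GL (Fin 2) ℝ)} (c : cuspsSubMulAction Γ) : ExtendedHalfPlane Γ :=
  Sum.inr c

/-- `Γ` acts on `ℍ*` by Möbius transformations, on the points of `ℍ` and on the cusps. -/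
instance (Γ : Subgroup (GL (Fin 2) ℝ)) : MulAction Γ (ExtendedHalfPlane Γ) :=
  inferInstanceAs (MulAction Γ (ℍ ⊕ cuspsSubMulAction Γ))

/-- The horocycle topology on `ℍ*`: a set is open if its part in `ℍ` is open and if it contains,
with each cusp `c`, a horoball `{g z : Im z > A}` at `c` (where `g ∞ = c`). -/
instance (Γ : Subgroup (GL (Fin 2) ℝ)) : TopologicalSpace (ExtendedHalfPlane Γ) where
  IsOpen U := IsOpen {z : ℍ | ofPoint z ∈ U} ∧
    ∀ c : cuspsSubMulAction Γ, ofCusp c ∈ U → ∀ g : GL (Fin 2) ℝ,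
      g • (OnePoint.infty : OnePoint ℝ) = c → ∀ᶠ z : ℍ in atImInfty, ofPoint (g • z) ∈ U
  isOpen_univ := by simp
  isOpen_inter U V hU hV :=
    ⟨hU.1.inter hV.1, fun c hc g hg => (hU.2 c hc.1 g hg).and (hV.2 c hc.2 g hg)⟩
  isOpen_sUnion S hS := by
    refine ⟨?_, fun c hc g hg => ?_⟩
    · have h : {z : ℍ | (ofPoint z : ExtendedHalfPlane Γ) ∈ ⋃₀ S} =
          ⋃ U ∈ S, {z : ℍ | ofPoint z ∈ U} := by ext z; simp
      rw [h]
      exact isOpen_biUnion fun U hU => (hS U hU).1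
    · obtain ⟨U, hU, hcU⟩ := hc
      exact ((hS U hU).2 c hcU g hg).mono fun z hz => ⟨U, hU, hz⟩

end ExtendedHalfPlane

open ExtendedHalfPlane

/-- `Γ` is a Fuchsian group of the first kind: a discrete group of matrices of determinant one
such that the quotient `Γ \ ℍ*` is compact. -/
structure IsFuchsianFirstKind (Γ : Subgroup (GL (Fin 2) ℝ)) : Prop where
  hasDetOne : Γ.HasDetOne
  discrete : DiscreteTopology Γ
  compact : CompactSpace (MulAction.orbitRel.Quotient Γ (ExtendedHalfPlane Γ))

/-- `σ` is a scaling matrix of the cusp `c` of `Γ`: `σ ∈ SL₂(ℝ)`, `σ ∞ = c`, and in `PSL₂(ℝ)` one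
has `σ⁻¹ Γ_c σ = {± (1 m; 0 1) : m ∈ ℤ}` where `Γ_c` is the stabilizer of `c` in `Γ`.
(`Γ.adjoinNegOne` is the full preimage in `SL₂(ℝ)` of the image of `Γ` in `PSL₂(ℝ)`.) -/
structure IsScalingMatrix (Γ : Subgroup (GL (Fin 2) ℝ)) (c : OnePoint ℝ) (σ : GL (Fin 2) ℝ) :
    Prop where
  det_eq_one : σ.det = 1
  smul_infty : σ • (OnePoint.infty : OnePoint ℝ) = c
  stabilizer : ∀ g : GL (Fin 2) ℝ, (g ∈ Γ.adjoinNegOne ∧ g • c = c) ↔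
    ∃ m : ℤ, σ⁻¹ * g * σ = upperRightHom (m : ℝ) ∨ σ⁻¹ * g * σ = -upperRightHom (m : ℝ)

/-! ### Cusp forms of higher order -/

/-- The space `S_k^t(Γ)` of cusp forms of order `t` and weight `k`, by recursion on `t`. In the
last condition the bound holds as `Im z → ∞`, uniformly in `Re z`. -/
def higherCuspForms (Γ : Subgroup (GL (Fin 2) ℝ)) (k : ℤ) : ℕ → Set (ℍ → ℂ)
  | 0 => {0}
  | t + 1 => {f | MDiff f ∧
      (∀ γ ∈ Γ, f ∣[k] γ - f ∈ higherCuspForms Γ k t) ∧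
      (∀ π ∈ Γ, π.IsParabolic → f ∣[k] π = f) ∧
      ∀ c : OnePoint ℝ, IsCusp c Γ → ∀ σ : GL (Fin 2) ℝ, IsScalingMatrix Γ c σ →
        ∃ a : ℝ, 0 < a ∧ (f ∣[k] σ) =O[atImInfty] fun z : ℍ => Real.exp (-a * z.im)}

/-- The map `f|₂(· - 1) : γ ↦ f|₂γ - f` on `Γ`. -/
def slashDiff (Γ : Subgroup (GL (Fin 2) ℝ)) (f : ℍ → ℂ) : Γ → ℍ → ℂ :=
  fun γ => f ∣[(2 : ℤ)] (γ : GL (Fin 2) ℝ) - f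

/-! ### Integrals between points of `ℍ*` -/

/-- `∫_z^w f(u) du` along the straight segment from `z` to `w` in `ℍ` (for holomorphic `f` this is
the integral along any path in `ℍ`). -/
def segmentIntegral (f : ℍ → ℂ) (z w : ℍ) : ℂ :=
  ∫ s in (0 : ℝ)..1, ((w : ℂ) - z) * f (ofComplex ((z : ℂ) + s * ((w : ℂ) - z)))

/-- The point `i y` if `c = ∞`, and the point `x + i / y` if `c = x ∈ ℝ` (for `y > 0`): as
`y → ∞` it tends to `c` along a geodesic. -/
def geodesicTo (c : OnePoint ℝ) (y : ℝ) : ℍ :=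
  ofComplex (match c with
    | none => (y : ℂ) * Complex.I
    | some x => (x : ℂ) + ((1 / y : ℝ) : ℂ) * Complex.I)

/-- A path of points of `ℍ` that ends in the given point of `ℍ*` as the parameter tends to `∞`:
constant at a point of `ℍ`, a vertical geodesic at a cusp. -/
def pathTo {Γ : Subgroup (GL (Fin 2) ℝ)} (p : ExtendedHalfPlane Γ) (y : ℝ) : ℍ :=
  match p with
  | Sum.inl z => z
  | Sum.inr c => geodesicTo c y

/-- The (possibly improper) integral `∫_p^q f(w) dw` converges to `v`, for `p, q ∈ ℍ*`. -/
def HasPathIntegral {Γ : Subgroup (GL (Fin 2) ℝ)} (f : ℍ → ℂ) (p q : ExtendedHalfPlane Γ)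
    (v : ℂ) : Prop :=
  Tendsto (fun y : ℝ => segmentIntegral f (pathTo p y) (pathTo q y)) atTop (𝓝 v)

/-- The value of `∫_p^q f(w) dw` for `p, q ∈ ℍ*`. -/
def pathIntegral {Γ : Subgroup (GL (Fin 2) ℝ)} (f : ℍ → ℂ) (p q : ExtendedHalfPlane Γ) : ℂ :=
  limUnder atTop fun y : ℝ => segmentIntegral f (pathTo p y) (pathTo q y)

theorem HasPathIntegral.pathIntegral_eq {Γ : Subgroup (GL (Fin 2) ℝ)} {f : ℍ → ℂ}
    {p q : ExtendedHalfPlane Γ} {v : ℂ} (h : HasPathIntegral f p q v) : pathIntegral f p q = v :=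
  h.limUnder_eq

theorem hasPathIntegral_ofPoint {Γ : Subgroup (GL (Fin 2) ℝ)} (f : ℍ → ℂ) (z w : ℍ) :
    HasPathIntegral f (ofPoint z : ExtendedHalfPlane Γ) (ofPoint w) (segmentIntegral f z w) :=
  tendsto_const_nhds

/-! ### The spaces `𝓗_t` -/

/-- Given families `A r` of functions, the space of maps `Γ → ℂ` generated by the products
`γ ↦ ∏ᵢ (∫_{zᵢ}^{γ zᵢ} fᵢ(w) dw)^±` with `zᵢ ∈ ℍ*`, `fᵢ ∈ A rᵢ` and `∑ᵢ rᵢ = r`, where each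
factor may or may not be replaced by its complex conjugate. -/
def periodMaps (Γ : Subgroup (GL (Fin 2) ℝ)) (A : ℕ → Set (ℍ → ℂ)) (r : ℕ) :
    Submodule ℂ (Γ → ℂ) :=
  Submodule.span ℂ {φ | ∃ (m : ℕ) (ρ : Fin m → ℕ) (f : Fin m → ℍ → ℂ)
    (z : Fin m → ExtendedHalfPlane Γ) (conjugate : Fin m → Bool),
    (∀ i, f i ∈ A (ρ i)) ∧ ∑ i, ρ i = r ∧
    φ = fun γ => ∏ i, if conjugate i then conj (pathIntegral (f i) (z i) (γ • z i))
      else pathIntegral (f i) (z i) (γ • z i)}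

/-- The sum of the images in `Maps(Γ, Maps(ℍ, ℂ))` of the spaces `H_r ⊗ S_2^s` with `r + s ≤ t`
and `1 ≤ r, s ≤ t - 1`, where `H_r` is `periodMaps Γ A r`; zero if `t ≤ 1`. -/
def mixedMaps (Γ : Subgroup (GL (Fin 2) ℝ)) (A : ℕ → Set (ℍ → ℂ)) (t : ℕ) :
    Submodule ℂ (Γ → ℍ → ℂ) :=
  if t ≤ 1 then ⊥ else
    Submodule.span ℂ {Φ | ∃ r s : ℕ, r + s ≤ t ∧ (1 ≤ r ∧ r ≤ t - 1) ∧ (1 ≤ s ∧ s ≤ t - 1) ∧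
      ∃ φ ∈ periodMaps Γ A r, ∃ h ∈ higherCuspForms Γ 2 s, Φ = fun γ => φ γ • h}

/-- The space `𝓗_t`, as a space of maps from `Γ` to functions on `ℍ`, by recursion on `t`: the
functions `fᵢ` allowed in the integrals are the `fᵢ ∈ S_2^{rᵢ}` with `fᵢ|₂(· - 1) ∈ 𝓗_{rᵢ}`.
The clause `r < t` only serves the recursion, see `calH_eq`. -/
def calH (Γ : Subgroup (GL (Fin 2) ℝ)) (t : ℕ) : Submodule ℂ (Γ → ℍ → ℂ) :=
  mixedMaps Γ
    (fun r => {f | ∃ _ : r < t, f ∈ higherCuspForms Γ 2 r ∧ slashDiff Γ f ∈ calH Γ r}) t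
  termination_by t

/-- The recursive description of `𝓗_t` without the clause `r < t`. -/
theorem calH_eq (Γ : Subgroup (GL (Fin 2) ℝ)) (t : ℕ) :
    calH Γ t = mixedMaps Γ
      (fun r => {f | f ∈ higherCuspForms Γ 2 r ∧ slashDiff Γ f ∈ calH Γ r}) t := by
  rw [calH]
  unfold mixedMaps
  split_ifs with ht
  · rfl
  have key : ∀ r, r ≤ t - 1 →
      periodMaps Γ
        (fun r => {f | ∃ _ : r < t, f ∈ higherCuspForms Γ 2 r ∧ slashDiff Γ f ∈ calH Γ r}) r =
      periodMaps Γ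
        (fun r => {f | f ∈ higherCuspForms Γ 2 r ∧ slashDiff Γ f ∈ calH Γ r}) r := by
    intro r hr
    unfold periodMaps
    congr 1
    ext φ
    constructor
    · rintro ⟨m, ρ, f, z, e, hf, hs, hφ⟩
      exact ⟨m, ρ, f, z, e, fun i => (hf i).2, hs, hφ⟩
    · rintro ⟨m, ρ, f, z, e, hf, hs, hφ⟩
      refine ⟨m, ρ, f, z, e, fun i => ⟨?_, hf i⟩, hs, hφ⟩
      have := Finset.single_le_sum (f := ρ) (fun _ _ => Nat.zero_le _) (Finset.mem_univ i)
      omega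
  congr 1
  ext Φ
  constructor
  · rintro ⟨r, s, h1, h2, h3, φ, hφ, h⟩
    exact ⟨r, s, h1, h2, h3, φ, key r h2.2 ▸ hφ, h⟩
  · rintro ⟨r, s, h1, h2, h3, φ, hφ, h⟩
    exact ⟨r, s, h1, h2, h3, φ, (key r h2.2).symm ▸ hφ, h⟩

end

/-! Two facts drive the proof. A form of order `t + 1` is fixed by every group element that fixes a
cusp, and every other `γ` changes it only by a form of order `t`. So if `γ` is a word of length `n`
in "letters" that either lie in a fixed finite set `S` or fix a cusp, the cocycle identity `f|δγ' =
f|γ' + (f|(δ - 1))|γ'` writes `f|γ` as `f` plus at most `n` translates of forms of lower order. Only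
the finitely many forms `f|(δ - 1)` with `δ ∈ S` occur, so induction on the order gives a bound
polynomial in `n` with uniform constants (`exists_bound_slash_letters_pow`).

Reduction theory makes the words short. Shimizu's lemma separates the cusps: heights of one point in
two different cusps have product at most `1` (`IsScalingMatrix.im_mul_im_le_one`). With compactness
of the quotient this yields a set `F` meeting every orbit, such that elements moving a point of `F`
to within distance `1` of `F` are letters (`exists_reduction`). A point is reached by walking along
a vertical geodesic from height `1` in steps of hyperbolic length at most `1`; each step costs one
letter. The word length is therefore at most logarithmic in the height
(`exists_mem_letters_pow_smul_mem`).

For (i), `Im z |f(z)|` is the invariant size of a weight two form and is bounded on `F` for each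
fixed form; moving `z` into `F` and applying the word bound finishes. For (ii), a primitive has
limits at the cusps, is bounded high in a cusp, and lower down is controlled by integrating (i)
against `dy / y`, which costs one more logarithm. For (iii), the period is `∫_{z₀}^{γz} f -
∫_{γz₀}^{γz} f`. The first integral is covered by (ii); the second equals `∫_{z₀}^{z} f|γ`, to which
the word bound applies with the functional `f ↦ |∫_{z₀}^{z} f|`, since `γ` is a word whose length is
bounded by the logarithms of the heights of `z` and `γz`. -/

noncomputable section

open ExtendedHalfPlane

/-! ### Discrete groups of matrices of determinant one -/

/-- A matrix of determinant one in `GL₂(ℝ)` comes from `SL₂(ℝ)`. -/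
theorem exists_toGL_eq {g : GL (Fin 2) ℝ} (hg : g.det = 1) :
    ∃ s : SL(2, ℝ), Matrix.SpecialLinearGroup.toGL s = g := by
  refine ⟨⟨g.val, ?_⟩, ?_⟩
  · simpa [Units.ext_iff] using hg
  · ext; rfl

theorem dist_smul_smul_of_det_eq_one {g : GL (Fin 2) ℝ} (hg : g.det = 1) (z w : ℍ) :
    dist (g • z) (g • w) = dist z w := by
  obtain ⟨s, rfl⟩ := exists_toGL_eq hg
  exact dist_smul s z w

theorem det_entries_eq_one {g : GL (Fin 2) ℝ} (hg : g.det = 1) :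
    g 0 0 * g 1 1 - g 0 1 * g 1 0 = 1 := by
  have := congrArg Units.val hg
  rwa [val_det_apply, Matrix.det_fin_two, Units.val_one] at this

theorem inv_entries_of_det_eq_one {g : GL (Fin 2) ℝ} (hg : g.det = 1) :
    g⁻¹ 0 0 = g 1 1 ∧ g⁻¹ 0 1 = -g 0 1 ∧ g⁻¹ 1 0 = -g 1 0 ∧ g⁻¹ 1 1 = g 0 0 := by
  have h : (g⁻¹).val = g.val.adjugate := by
    have hd : g.val.det = 1 := by simpa [Units.ext_iff] using hg
    rw [Matrix.coe_units_inv, Matrix.inv_def, hd, Ring.inverse_one, one_smul]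
  rw [h, Matrix.adjugate_fin_two]
  simp

section Discrete

variable {G : Subgroup (GL (Fin 2) ℝ)}


theorem discreteTopology_comap_toGL [DiscreteTopology G] :
    DiscreteTopology (Subgroup.comap Matrix.SpecialLinearGroup.toGL G : Subgroup SL(2, ℝ)) := by
  refine DiscreteTopology.of_continuous_injective (β := G)
    (f := fun s => ⟨Matrix.SpecialLinearGroup.toGL s.1, s.2⟩) ?_ ?_
  · exact (Matrix.SpecialLinearGroup.continuous_toGL.comp continuous_subtype_val).subtype_mk _
  · intro a b h
    exact Subtype.ext (Matrix.SpecialLinearGroup.toGL_injective (congrArg Subtype.val h))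

theorem finite_setOf_smul_mem [DiscreteTopology G] (hdet : ∀ g ∈ G, g.det = 1) {K L : Set ℍ}
    (hK : IsCompact K) (hL : IsCompact L) : {g ∈ G | ∃ z ∈ K, g • z ∈ L}.Finite := by
  have := discreteTopology_comap_toGL (G := G)
  have h : ProperlyDiscontinuousSMul
    (Subgroup.comap (Matrix.SpecialLinearGroup.toGL (n := Fin 2) (R := ℝ)) G : Subgroup SL(2, ℝ)) ℍ := inferInstance
  rw [Subgroup.properlyDiscontinuousSMul_iff] at h
  refine ((h hK hL).image Matrix.SpecialLinearGroup.toGL).subset ?_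
  rintro g ⟨hg, z, hz, hgz⟩
  obtain ⟨s, rfl⟩ := exists_toGL_eq (hdet g hg)
  exact ⟨s, ⟨hg, ⟨s • z, ⟨z, hz, rfl⟩, hgz⟩⟩, rfl⟩

/-- A discrete subgroup is closed, so its intersection with a compact set of matrices is compact and
discrete. -/
theorem finite_setOf_abs_apply_le [DiscreteTopology G] (hdet : ∀ g ∈ G, g.det = 1) (R : ℝ) :
    {g ∈ G | ∀ i j, |g i j| ≤ R}.Finite := by
  have hd := discreteTopology_comap_toGL (G := G)
  set G' : Subgroup SL(2, ℝ) := Subgroup.comap Matrix.SpecialLinearGroup.toGL G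
  have hcl : IsClosed (G' : Set SL(2, ℝ)) := Subgroup.isClosed_of_discrete
  let C : Set (Matrix (Fin 2) (Fin 2) ℝ) :=
    Set.univ.pi fun _ => Set.univ.pi fun _ => Set.Icc (-R) R
  have hC : IsCompact C := isCompact_univ_pi fun _ => isCompact_univ_pi fun _ => isCompact_Icc
  have hC' : IsCompact ((fun s : SL(2, ℝ) => (s : Matrix (Fin 2) (Fin 2) ℝ)) ⁻¹' C) :=
    Matrix.SpecialLinearGroup.isClosedEmbedding_val.isCompact_preimage hC
  have hfin : ((G' : Set SL(2, ℝ)) ∩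
      (fun s : SL(2, ℝ) => (s : Matrix (Fin 2) (Fin 2) ℝ)) ⁻¹' C).Finite := by
    refine (hC'.inter_left hcl).finite ?_
    exact ⟨hd.of_subset Set.inter_subset_left⟩
  refine (hfin.image Matrix.SpecialLinearGroup.toGL).subset ?_
  rintro g ⟨hg, hgR⟩
  obtain ⟨s, rfl⟩ := exists_toGL_eq (hdet g hg)
  exact ⟨s, ⟨hg, fun i _ j _ => abs_le.mp (hgR i j)⟩, rfl⟩

theorem upperRightHom_conj_entries {g : GL (Fin 2) ℝ} (hg : g.det = 1) (x : ℝ) :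
    (g * upperRightHom x * g⁻¹) 0 0 = 1 - x * (g 0 0 * g 1 0) ∧
    (g * upperRightHom x * g⁻¹) 0 1 = x * g 0 0 ^ 2 ∧
    (g * upperRightHom x * g⁻¹) 1 0 = -(x * g 1 0 ^ 2) ∧
    (g * upperRightHom x * g⁻¹) 1 1 = 1 + x * (g 0 0 * g 1 0) := by
  have hdet := det_entries_eq_one hg
  obtain ⟨h00, h01, h10, h11⟩ := inv_entries_of_det_eq_one hg
  simp only [Units.val_mul, upperRightHom_apply, Matrix.mul_apply, Fin.sum_univ_two,
    Matrix.of_apply, Matrix.cons_val', Matrix.cons_val_zero, Matrix.cons_val_one,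
    Matrix.cons_val_fin_one, h00, h01, h10, h11]
  refine ⟨?_, ?_, ?_, ?_⟩
  · linear_combination hdet
  · ring
  · ring
  · linear_combination hdet

/-- **Shimizu's lemma**. -/
theorem one_le_abs_of_upperRightHom_one_mem [DiscreteTopology G] (hdet : ∀ g ∈ G, g.det = 1)
    (hT : upperRightHom (1 : ℝ) ∈ G) {g : GL (Fin 2) ℝ} (hg : g ∈ G) (hc : g 1 0 ≠ 0) :
    1 ≤ |g 1 0| := by
  by_contra! hlt
  -- Iterating `u ↦ u T u⁻¹` replaces the lower left entry `c` by `-c²`. If `0 < |c| < 1` this never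
  -- reaches zero and strictly decreases in size, giving infinitely many group elements with bounded
  -- entries.
  obtain ⟨u, hu0, hu⟩ : ∃ u : ℕ → GL (Fin 2) ℝ, u 0 = g ∧
      ∀ n, u (n + 1) = u n * upperRightHom 1 * (u n)⁻¹ :=
    ⟨fun n => Nat.rec g (fun _ h => h * upperRightHom 1 * h⁻¹) n, rfl, fun _ => rfl⟩
  have huG (n : ℕ) : u n ∈ G := by
    induction n with
    | zero => rwa [hu0]
    | succ n ih => rw [hu]; exact mul_mem (mul_mem ih hT) (inv_mem ih)
  have hent (n : ℕ) := upperRightHom_conj_entries (hdet _ (huG n)) 1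
  simp only [← hu, one_mul] at hent
  have hc1 (n : ℕ) : |u n 1 0| ≤ |g 1 0| ∧ u n 1 0 ≠ 0 ∧ |u (n + 1) 1 0| < |u n 1 0| := by
    have key (n : ℕ) (h1 : |u n 1 0| ≤ |g 1 0|) (h2 : u n 1 0 ≠ 0) :
        |u (n + 1) 1 0| < |u n 1 0| := by
      rw [(hent n).2.2.1, abs_neg, abs_pow, pow_two]
      have := abs_pos.mpr h2
      nlinarith
    induction n with
    | zero => rw [← hu0] at hc ⊢; exact ⟨le_rfl, hc, key 0 (by rw [hu0]) hc⟩
    | succ n ih =>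
      have h1 := ih.2.2.le.trans ih.1
      have h2 : u (n + 1) 1 0 ≠ 0 := by
        rw [(hent n).2.2.1]; exact neg_ne_zero.mpr (pow_ne_zero _ ih.2.1)
      exact ⟨h1, h2, key _ h1 h2⟩
  set r := |g 1 0| with hr
  have hr0 : 0 ≤ r := abs_nonneg _
  -- The upper left entry evolves by `a ↦ 1 - a c` with `|c| ≤ r`; the bound `B` is preserved
  -- because `1 + B r ≤ B`.
  set B := max |g 0 0| (1 / (1 - r)) with hB
  have hB1 : 1 + B * r ≤ B := by
    have h1 : 1 / (1 - r) ≤ B := le_max_right _ _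
    rw [div_le_iff₀ (by linarith)] at h1
    linarith
  have hB0 : 0 ≤ B := (abs_nonneg _).trans (le_max_left _ _)
  have ha (n : ℕ) : |u n 0 0| ≤ B := by
    induction n with
    | zero => rw [hu0]; exact le_max_left _ _
    | succ n ih =>
      rw [(hent n).1]
      calc |1 - u n 0 0 * u n 1 0| ≤ 1 + |u n 0 0| * |u n 1 0| := by
            rw [← abs_mul]; exact (abs_sub _ _).trans (by simp)
        _ ≤ 1 + B * r := by gcongr; exact (hc1 n).1
        _ ≤ B := hB1
  have hbd (n : ℕ) : ∀ i j, |u (n + 1) i j| ≤ B + B ^ 2 + 1 := by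
    have h0 := ha (n + 1)
    have h1 := (hc1 (n + 1)).1
    have h2 : |u (n + 1) 0 1| ≤ B ^ 2 := by
      rw [(hent n).2.1, abs_pow]; gcongr; exact ha n
    have h3 : |u (n + 1) 1 1| ≤ B := by
      rw [(hent n).2.2.2]
      calc |1 + u n 0 0 * u n 1 0| ≤ 1 + |u n 0 0| * |u n 1 0| := by
            rw [← abs_mul]; exact (abs_add_le _ _).trans (by simp)
        _ ≤ 1 + B * r := by gcongr; exacts [ha n, (hc1 n).1]
        _ ≤ B := hB1
    have := sq_nonneg B
    intro i j
    fin_cases i <;> fin_cases j <;> simp only [Fin.zero_eta, Fin.mk_one, Fin.isValue] <;> linarith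
  have hanti : StrictAnti fun n => |u n 1 0| := strictAnti_nat_of_succ_lt fun n => (hc1 n).2.2
  have hinj : Function.Injective fun n => u (n + 1) := by
    intro m n h
    have := hanti.injective (congrArg (fun k : GL (Fin 2) ℝ => |k 1 0|) h)
    omega
  refine Set.infinite_range_of_injective hinj
    ((finite_setOf_abs_apply_le hdet (B + B ^ 2 + 1)).subset ?_)
  rintro _ ⟨n, rfl⟩
  exact ⟨huG _, hbd n⟩

end Discrete

end

noncomputable section

open ExtendedHalfPlane

/-! ### Scaling matrices -/

theorem coe_upperRightHom_smul (x : ℝ) (z : ℍ) : ((upperRightHom x • z : ℍ) : ℂ) = z + x := by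
  rw [coe_smul_of_det_pos (by simp [upperRightHom_apply])]
  simp [num, denom, upperRightHom_apply]

theorem upperRightHom_conj_of_apply_eq_zero {g : GL (Fin 2) ℝ} (hg : g.det = 1) (h : g 1 0 = 0)
    (x : ℝ) : g * upperRightHom x * g⁻¹ = upperRightHom (x * g 0 0 ^ 2) := by
  obtain ⟨h00, h01, h10, h11⟩ := upperRightHom_conj_entries hg x
  ext i j
  fin_cases i <;> fin_cases j <;> simp_all [upperRightHom_apply]

/-- This is `Im (gz) = Im z / |cz + d|²` together with `|cz + d| ≥ |c| Im z`. -/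
theorem im_smul_mul_im_le_one {g : GL (Fin 2) ℝ} (hg : g.det = 1) (h : 1 ≤ |g 1 0|) (z : ℍ) :
    (g • z).im * z.im ≤ 1 := by
  have h1 := c_mul_im_sq_le_normSq_denom g z
  have h2 := normSq_denom_pos g z.im_ne_zero
  have h3 : 1 ≤ g 1 0 ^ 2 := by rw [← sq_abs]; nlinarith
  have h4 : (g.det.val : ℝ) = 1 := by rw [hg]; rfl
  rw [im_smul_eq_div_normSq, h4, abs_one, one_mul, div_mul_eq_mul_div, div_le_one h2]
  refine le_trans ?_ h1
  have := sq_nonneg z.im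
  rw [mul_pow]
  nlinarith

/-- The conjugate `g⁻¹ G g`. -/
def conjSubgroup (G : Subgroup (GL (Fin 2) ℝ)) (g : GL (Fin 2) ℝ) : Subgroup (GL (Fin 2) ℝ) :=
  G.comap (MulAut.conj g).toMonoidHom

theorem mem_conjSubgroup {G : Subgroup (GL (Fin 2) ℝ)} {g h : GL (Fin 2) ℝ} :
    h ∈ conjSubgroup G g ↔ g * h * g⁻¹ ∈ G := Iff.rfl

instance (G : Subgroup (GL (Fin 2) ℝ)) [DiscreteTopology G] (g : GL (Fin 2) ℝ) :
    DiscreteTopology (conjSubgroup G g) := by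
  refine DiscreteTopology.of_continuous_injective (β := G)
    (f := fun s => ⟨g * s.1 * g⁻¹, s.2⟩) (by fun_prop) ?_
  intro a b h
  have := congrArg Subtype.val h
  simp only [mul_left_inj, mul_right_inj] at this
  exact Subtype.ext this

theorem det_eq_one_of_mem_conjSubgroup {G : Subgroup (GL (Fin 2) ℝ)}
    (hdet : ∀ g ∈ G, g.det = 1) (g : GL (Fin 2) ℝ) : ∀ h ∈ conjSubgroup G g, h.det = 1 := by
  intro h hh
  simpa using hdet _ (mem_conjSubgroup.mp hh)

theorem IsFuchsianFirstKind.det_eq_one {Γ : Subgroup (GL (Fin 2) ℝ)} (hΓ : IsFuchsianFirstKind Γ) :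
    ∀ g ∈ Γ.adjoinNegOne, g.det = 1 := by
  intro g hg
  have := hΓ.hasDetOne
  exact ((Subgroup.hasDetOne_adjoinNegOne_iff (𝒢 := Γ) (by simp)).mpr this).det_eq hg

theorem IsFuchsianFirstKind.discreteTopology_adjoinNegOne {Γ : Subgroup (GL (Fin 2) ℝ)}
    (hΓ : IsFuchsianFirstKind Γ) : DiscreteTopology Γ.adjoinNegOne := by
  have := hΓ.discrete
  infer_instance

/-- The elements of a discrete group with cusp `∞` that fix `∞` are `± (1 x; 0 1)`. -/
theorem eq_upperRightHom_or_neg_of_apply_eq_zero {H : Subgroup (GL (Fin 2) ℝ)}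
    [DiscreteTopology H] (hdet : ∀ g ∈ H, g.det = 1) (hpos : 0 < H.strictWidthInfty)
    {h : GL (Fin 2) ℝ} (hh : h ∈ H) (h10 : h 1 0 = 0) :
    ∃ x : ℝ, h = upperRightHom x ∨ h = -upperRightHom x := by
  set w := H.strictWidthInfty
  have hper : H.strictPeriods = AddSubgroup.zmultiples w :=
    Subgroup.strictPeriods_eq_zmultiples_strictWidthInfty
  have hw : upperRightHom w ∈ H :=
    Subgroup.mem_strictPeriods_iff.mp H.strictWidthInfty_mem_strictPeriods
  -- Conjugating the translation by the width `w` gives the translation by `a² w`, so `a²` is an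
  -- integer. The same holds for `a⁻²`, which forces `a² = 1`.
  have key (g : GL (Fin 2) ℝ) (hg : g ∈ H) (hg0 : g 1 0 = 0) : ∃ n : ℤ, (n : ℝ) = g 0 0 ^ 2 := by
    have h1 : g * upperRightHom w * g⁻¹ ∈ H := mul_mem (mul_mem hg hw) (inv_mem hg)
    rw [upperRightHom_conj_of_apply_eq_zero (hdet g hg) hg0, ← Subgroup.mem_strictPeriods_iff,
      hper, AddSubgroup.mem_zmultiples_iff] at h1
    obtain ⟨n, hn⟩ := h1
    refine ⟨n, mul_left_cancel₀ hpos.ne' ?_⟩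
    rw [← hn, zsmul_eq_mul, mul_comm]
  have hd := det_entries_eq_one (hdet h hh)
  rw [h10, mul_zero, sub_zero] at hd
  obtain ⟨i00, i01, i10, i11⟩ := inv_entries_of_det_eq_one (hdet h hh)
  obtain ⟨m, hm⟩ := key h hh h10
  obtain ⟨n, hn⟩ := key h⁻¹ (inv_mem hh) (by rw [i10, h10, neg_zero])
  rw [i00] at hn
  have hmn : m * n = 1 := by
    have : (m * n : ℝ) = 1 := by rw [hm, hn, ← mul_pow, hd, one_pow]
    exact_mod_cast this
  have hm0 : 0 ≤ m := by
    have : (0 : ℝ) ≤ m := hm ▸ sq_nonneg _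
    exact_mod_cast this
  have hm1 : m = 1 := by
    rcases Int.mul_eq_one_iff_eq_one_or_neg_one.mp hmn with h | h
    · exact h.1
    · omega
  rw [hm1, Int.cast_one] at hm
  rcases sq_eq_one_iff.mp hm.symm with ha | ha <;> rw [ha] at hd
  · refine ⟨h 0 1, .inl ?_⟩
    ext i j
    fin_cases i <;> fin_cases j <;> simp [upperRightHom_apply, ha, h10]
    linarith
  · refine ⟨-h 0 1, .inr ?_⟩
    ext i j
    fin_cases i <;> fin_cases j <;> simp [upperRightHom_apply, ha, h10]
    linarith

/-- Move the cusp to `∞`, then rescale by `diag(√w, 1/√w)`, where `w` is the width of the conjugated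
group, so that the width becomes `1`. -/
theorem exists_isScalingMatrix {Γ : Subgroup (GL (Fin 2) ℝ)} (hΓ : IsFuchsianFirstKind Γ)
    {c : OnePoint ℝ} (hc : IsCusp c Γ) : ∃ σ : GL (Fin 2) ℝ, IsScalingMatrix Γ c σ := by
  have := hΓ.discreteTopology_adjoinNegOne
  obtain ⟨s, hs⟩ := OnePoint.exists_mem_SL2 (K := ℝ) ℝ c
  set g : GL (Fin 2) ℝ := Matrix.SpecialLinearGroup.mapGL ℝ s
  have hg : g.det = 1 := Matrix.SpecialLinearGroup.det_mapGL s
  set H := conjSubgroup Γ.adjoinNegOne g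
  have hdet := det_eq_one_of_mem_conjSubgroup hΓ.det_eq_one g
  have hneg {h : GL (Fin 2) ℝ} : -h ∈ H ↔ h ∈ H := by
    simp only [H, mem_conjSubgroup, Subgroup.mem_adjoinNegOne_iff, mul_neg, neg_mul, neg_neg]
    exact or_comm
  have : H.HasDetOne := ⟨fun h => hdet _ h⟩
  have hpos : 0 < H.strictWidthInfty := by
    rw [Subgroup.strictWidthInfty_pos_iff]
    obtain ⟨p, hp, hpp, hpc⟩ := hc
    refine ⟨g⁻¹ * p * g, ?_, ?_, ?_⟩
    · rw [mem_conjSubgroup]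
      convert Γ.le_adjoinNegOne hp using 1
      group
    · rwa [isParabolic_conj_iff']
    · rw [mul_smul, mul_smul, hs, hpc, ← hs, inv_smul_smul]
  set w := H.strictWidthInfty
  have hper : H.strictPeriods = AddSubgroup.zmultiples w :=
    Subgroup.strictPeriods_eq_zmultiples_strictWidthInfty
  have hw0 : √w ≠ 0 := (Real.sqrt_pos.mpr hpos).ne'
  let D : GL (Fin 2) ℝ := .mkOfDetNeZero !![√w, 0; 0, (√w)⁻¹] (by simp [hw0])
  have hD : D.det = 1 := by ext; simp [D, hw0]
  have hDT (x : ℝ) : D * upperRightHom x * D⁻¹ = upperRightHom (x * w) := by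
    rw [upperRightHom_conj_of_apply_eq_zero hD (by simp [D])]
    simp [D, Real.sq_sqrt hpos.le]
  have hDinf : D • (OnePoint.infty : OnePoint ℝ) = OnePoint.infty := by
    rw [OnePoint.smul_infty_eq_self_iff]; simp [D]
  refine ⟨g * D, ?_, ?_, ?_⟩
  · rw [map_mul, hg, hD, one_mul]
  · rw [mul_smul, hDinf, hs]
  · intro h
    have hconj (x : GL (Fin 2) ℝ) : (g * D)⁻¹ * h * (g * D) = x ↔ g⁻¹ * h * g = D * x * D⁻¹ := by
      constructor
      · rintro rfl; group
      · intro hx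
        calc (g * D)⁻¹ * h * (g * D) = D⁻¹ * (g⁻¹ * h * g) * D := by group
          _ = x := by rw [hx]; group
    have hH : h ∈ Γ.adjoinNegOne ↔ g⁻¹ * h * g ∈ H := by
      rw [mem_conjSubgroup]
      simp only [mul_assoc, mul_inv_cancel_left, mul_inv_cancel, mul_one]
    have hfix : h • c = c ↔ (g⁻¹ * h * g) 1 0 = 0 := by
      rw [← OnePoint.smul_infty_eq_self_iff, mul_smul, mul_smul, hs, inv_smul_eq_iff, hs]
    simp only [hconj, mul_neg, neg_mul, hDT, hH, hfix]
    have hmem (x : ℝ) : upperRightHom x ∈ H ↔ ∃ m : ℤ, x = m * w := by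
      rw [← Subgroup.mem_strictPeriods_iff, hper, AddSubgroup.mem_zmultiples_iff]
      simp only [zsmul_eq_mul, eq_comm]
    constructor
    · rintro ⟨h1, h2⟩
      obtain ⟨x, hx⟩ := eq_upperRightHom_or_neg_of_apply_eq_zero hdet hpos h1 h2
      have hxH : upperRightHom x ∈ H := by
        rcases hx with hx | hx <;> rw [hx] at h1
        · exact h1
        · exact hneg.mp h1
      obtain ⟨m, rfl⟩ := (hmem x).mp hxH
      exact ⟨m, hx⟩
    · rintro ⟨m, hm | hm⟩ <;> rw [hm]
      · exact ⟨(hmem _).mpr ⟨m, rfl⟩, by simp [upperRightHom_apply]⟩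
      · exact ⟨hneg.mpr ((hmem _).mpr ⟨m, rfl⟩), by simp [upperRightHom_apply]⟩

namespace IsScalingMatrix

variable {Γ : Subgroup (GL (Fin 2) ℝ)} {c c' : OnePoint ℝ} {σ σ' : GL (Fin 2) ℝ}

theorem conj_upperRightHom_mem (hσ : IsScalingMatrix Γ c σ) (m : ℤ) :
    σ * upperRightHom (m : ℝ) * σ⁻¹ ∈ Γ.adjoinNegOne ∧ (σ * upperRightHom (m : ℝ) * σ⁻¹) • c = c :=
  (hσ.stabilizer _).mpr ⟨m, .inl (by group)⟩

theorem exists_coe_smul_eq (hσ : IsScalingMatrix Γ c σ) {δ : GL (Fin 2) ℝ}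
    (hδ : δ ∈ Γ.adjoinNegOne) (hc : δ • c = c) :
    ∃ m : ℤ, ∀ z : ℍ, σ⁻¹ • δ • z = upperRightHom (m : ℝ) • (σ⁻¹ • z) := by
  obtain ⟨m, hm⟩ := (hσ.stabilizer δ).mp ⟨hδ, hc⟩
  refine ⟨m, fun z => ?_⟩
  have : σ⁻¹ • δ • z = (σ⁻¹ * δ * σ) • σ⁻¹ • z := by simp [mul_smul]
  rw [this]
  rcases hm with hm | hm <;> rw [hm]
  rw [UpperHalfPlane.neg_smul]

theorem im_inv_smul_smul (hσ : IsScalingMatrix Γ c σ) {δ : GL (Fin 2) ℝ}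
    (hδ : δ ∈ Γ.adjoinNegOne) (hc : δ • c = c) (z : ℍ) :
    (σ⁻¹ • δ • z).im = (σ⁻¹ • z).im := by
  obtain ⟨m, hm⟩ := hσ.exists_coe_smul_eq hδ hc
  rw [hm, ← coe_im, coe_upperRightHom_smul]
  simp

/-- The matrix `g = σ'⁻¹ δ σ` need not lie in a conjugate of the group, but `g T g⁻¹` lies in the
conjugate by `σ'`. Its lower left entry is `-(g 1 0)²`, so Shimizu's lemma gives `|g 1 0| ≥ 1`. -/
theorem im_mul_im_le_one (hΓ : IsFuchsianFirstKind Γ) (hσ : IsScalingMatrix Γ c σ)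
    (hσ' : IsScalingMatrix Γ c' σ') {δ : GL (Fin 2) ℝ} (hδ : δ ∈ Γ.adjoinNegOne)
    (hc : δ • c ≠ c') (z : ℍ) : (σ'⁻¹ • δ • z).im * (σ⁻¹ • z).im ≤ 1 := by
  have := hΓ.discreteTopology_adjoinNegOne
  have hz : σ'⁻¹ • δ • z = (σ'⁻¹ * δ * σ) • σ⁻¹ • z := by simp [mul_smul]
  rw [hz]
  set g := σ'⁻¹ * δ * σ with hgdef
  have hg : g.det = 1 := by
    simp [g, hσ.det_eq_one, hσ'.det_eq_one, hΓ.det_eq_one δ hδ]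
  have hg0 : g 1 0 ≠ 0 := by
    intro h
    rw [← OnePoint.smul_infty_eq_self_iff, mul_smul, mul_smul, hσ.smul_infty, inv_smul_eq_iff,
      hσ'.smul_infty] at h
    exact hc h
  have hT : upperRightHom (1 : ℝ) ∈ conjSubgroup Γ.adjoinNegOne σ' := by
    simpa [mem_conjSubgroup] using (hσ'.conj_upperRightHom_mem 1).1
  have hmem : g * upperRightHom (1 : ℝ) * g⁻¹ ∈ conjSubgroup Γ.adjoinNegOne σ' := by
    rw [mem_conjSubgroup]
    have h1 := mul_mem (mul_mem hδ (hσ.conj_upperRightHom_mem 1).1) (inv_mem hδ)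
    rw [Int.cast_one] at h1
    convert h1 using 1
    rw [hgdef]
    group
  have hent := (upperRightHom_conj_entries hg 1).2.2.1
  rw [one_mul] at hent
  have hS := one_le_abs_of_upperRightHom_one_mem
    (det_eq_one_of_mem_conjSubgroup hΓ.det_eq_one σ') hT hmem
    (by rw [hent]; exact neg_ne_zero.mpr (pow_ne_zero _ hg0))
  rw [hent, abs_neg, abs_pow] at hS
  refine im_smul_mul_im_le_one hg ?_ _
  exact (one_le_sq_iff₀ (abs_nonneg _)).mp hS

end IsScalingMatrix

end

noncomputable section

open ExtendedHalfPlane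

/-! ### Reduction theory -/

theorem neg_smul_onePoint (g : GL (Fin 2) ℝ) (c : OnePoint ℝ) : (-g) • c = g • c := by
  cases c with
  | infty => simp [OnePoint.smul_infty_eq_ite]
  | coe x =>
    have h : -(g 1 0 * x) + -g 1 1 = 0 ↔ g 1 0 * x + g 1 1 = 0 := by
      rw [← neg_add, neg_eq_zero]
    have h2 : -(g 0 0 * x) + -g 0 1 = -(g 0 0 * x + g 0 1) := by ring
    have h3 : -(g 1 0 * x) + -g 1 1 = -(g 1 0 * x + g 1 1) := by ring
    simp only [OnePoint.smul_some_eq_ite, Units.val_neg, Matrix.neg_apply, neg_mul, h]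
    rw [h2, h3, neg_div_neg_eq]

theorem isCompact_setOf_re_im_mem_Icc {a b x y : ℝ} (ha : 0 < a) :
    IsCompact {z : ℍ | z.re ∈ Set.Icc x y ∧ z.im ∈ Set.Icc a b} := by
  rw [isEmbedding_coe.isCompact_iff]
  convert (isCompact_Icc (a := x) (b := y)).reProdIm (isCompact_Icc (a := a) (b := b)) using 1
  ext w
  simp only [Set.mem_image, Set.mem_ofPred_eq, Complex.mem_reProdIm]
  constructor
  · rintro ⟨z, hz, rfl⟩; exact hz
  · intro hw
    exact ⟨⟨w, ha.trans_le hw.2.1⟩, hw, rfl⟩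

section Cover

variable {Γ : Subgroup (GL (Fin 2) ℝ)}

/-- A representative of the `Γ`-orbit of a cusp. -/
def cuspRep (d : cuspsSubMulAction Γ) : cuspsSubMulAction Γ :=
  Quotient.out (Quotient.mk (MulAction.orbitRel Γ (cuspsSubMulAction Γ)) d)

theorem exists_smul_cuspRep (d : cuspsSubMulAction Γ) : ∃ γ : Γ, γ • d = cuspRep d := by
  have h : (MulAction.orbitRel Γ (cuspsSubMulAction Γ)) (cuspRep d) d := Quotient.mk_out d
  exact MulAction.orbitRel_apply.mp h

theorem cuspRep_smul (γ : Γ) (d : cuspsSubMulAction Γ) : cuspRep (γ • d) = cuspRep d := by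
  unfold cuspRep
  congr 1
  exact Quotient.sound (MulAction.orbitRel_apply.mpr ⟨γ, rfl⟩)

/-- A `Γ`-invariant neighbourhood of a point of `ℍ*`. -/
def invariantNhd (σ : OnePoint ℝ → GL (Fin 2) ℝ) (A : ℝ) :
    ExtendedHalfPlane Γ → Set (ExtendedHalfPlane Γ)
  | Sum.inl p => Sum.elim (fun z => ∃ γ : Γ, dist (γ.1 • z) p < 1) fun _ => False
  | Sum.inr d => Sum.elim (fun z => ∃ γ : Γ, A < ((σ (cuspRep d).1)⁻¹ • γ.1 • z).im)
      fun e => cuspRep e = cuspRep d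

theorem mem_invariantNhd_self {σ : OnePoint ℝ → GL (Fin 2) ℝ} {A : ℝ} (p : ExtendedHalfPlane Γ) :
    p ∈ invariantNhd σ A p := by
  rcases p with p | d
  · exact ⟨1, by simp⟩
  · exact (rfl : cuspRep d = cuspRep d)

theorem smul_mem_invariantNhd {σ : OnePoint ℝ → GL (Fin 2) ℝ} {A : ℝ} {p q : ExtendedHalfPlane Γ}
    (γ : Γ) (h : q ∈ invariantNhd σ A p) : γ • q ∈ invariantNhd σ A p := by
  rcases p with p | d <;> rcases q with z | e
  · obtain ⟨δ, hδ⟩ := h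
    refine ⟨δ * γ⁻¹, ?_⟩
    have : (δ * γ⁻¹).1 • γ.1 • z = δ.1 • z := by simp [mul_smul]
    exact this ▸ hδ
  · exact h
  · obtain ⟨δ, hδ⟩ := h
    refine ⟨δ * γ⁻¹, ?_⟩
    have : (δ * γ⁻¹).1 • γ.1 • z = δ.1 • z := by simp [mul_smul]
    exact this ▸ hδ
  · exact (cuspRep_smul γ e).trans h

theorem isOpen_invariantNhd {σ : OnePoint ℝ → GL (Fin 2) ℝ}
    (hσ : ∀ c, IsCusp c Γ → IsScalingMatrix Γ c (σ c)) (A : ℝ) (p : ExtendedHalfPlane Γ) :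
    IsOpen (invariantNhd σ A p) := by
  rcases p with p | d
  · refine ⟨?_, fun c hc => hc.elim⟩
    have : {z : ℍ | (ofPoint z : ExtendedHalfPlane Γ) ∈ invariantNhd σ A (Sum.inl p)} =
        ⋃ γ : Γ, {z | dist (γ.1 • z) p < 1} := by
      ext z; simp only [Set.mem_iUnion]; rfl
    rw [this]
    exact isOpen_iUnion fun γ =>
      isOpen_lt ((continuous_const_smul γ.1).dist continuous_const) continuous_const
  · refine ⟨?_, fun c hc g hg => ?_⟩
    · have : {z : ℍ | (ofPoint z : ExtendedHalfPlane Γ) ∈ invariantNhd σ A (Sum.inr d)} =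
          ⋃ γ : Γ, {z | A < ((σ (cuspRep d).1)⁻¹ • γ.1 • z).im} := by
        ext z; simp only [Set.mem_iUnion]; rfl
      rw [this]
      refine isOpen_iUnion fun γ => isOpen_lt continuous_const (continuous_im.comp ?_)
      exact (continuous_const_smul (σ (cuspRep d).1)⁻¹).comp (continuous_const_smul γ.1)
    · have hc' : cuspRep c = cuspRep d := hc
      obtain ⟨γ, hγ⟩ := exists_smul_cuspRep c
      have hγ' : γ.1 • c.1 = (cuspRep d).1 := hc' ▸ congrArg Subtype.val hγ
      -- The composite fixes `∞`, so it carries high points to high points; this makes the condition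
      -- independent of the choice of `g`.
      have h0 : ((σ (cuspRep d).1)⁻¹ * γ.1 * g) 1 0 = 0 := by
        rw [← OnePoint.smul_infty_eq_self_iff, mul_smul, mul_smul, hg, hγ', inv_smul_eq_iff,
          (hσ _ (cuspRep d).2).smul_infty]
      have ht := tendsto_smul_atImInfty h0
      have hA : {z : ℍ | A < z.im} ∈ atImInfty :=
        (atImInfty_mem _).mpr ⟨A + 1, fun z hz => by simp only [Set.mem_ofPred_eq]; linarith⟩
      filter_upwards [ht hA] with z hz
      refine ⟨γ, ?_⟩
      simpa [mul_smul] using hz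

/-- Modulo `Γ`, the upper half plane is covered by a compact set and by finitely many horoballs at
inequivalent cusps. -/
theorem exists_compact_cover (hΓ : IsFuchsianFirstKind Γ) {σ : OnePoint ℝ → GL (Fin 2) ℝ}
    (hσ : ∀ c, IsCusp c Γ → IsScalingMatrix Γ c (σ c)) (A : ℝ) :
    ∃ (R : Set (OnePoint ℝ)) (K : Set ℍ), R.Finite ∧ IsCompact K ∧ (∀ c ∈ R, IsCusp c Γ) ∧
      (∀ c ∈ R, ∀ c' ∈ R, ∀ δ ∈ Γ.adjoinNegOne, δ • c = c' → c = c') ∧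
      ∀ z : ℍ, ∃ γ ∈ Γ.adjoinNegOne, γ • z ∈ K ∨ ∃ c ∈ R, A < ((σ c)⁻¹ • γ • z).im := by
  have := hΓ.compact
  let π : ExtendedHalfPlane Γ → MulAction.orbitRel.Quotient Γ (ExtendedHalfPlane Γ) :=
    Quotient.mk _
  -- The neighbourhoods are saturated for the action, so their images in the compact quotient are
  -- open.
  have hpre (p : ExtendedHalfPlane Γ) :
      π ⁻¹' (π '' invariantNhd σ A p) = invariantNhd σ A p := by
    refine Set.Subset.antisymm ?_ (Set.subset_preimage_image _ _)
    rintro q ⟨q', hq', hqq⟩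
    have h : (MulAction.orbitRel Γ (ExtendedHalfPlane Γ)) q q' := Quotient.exact hqq.symm
    obtain ⟨γ, rfl⟩ := MulAction.orbitRel_apply.mp h
    exact smul_mem_invariantNhd γ hq'
  obtain ⟨t, ht⟩ := isCompact_univ.elim_finite_subcover (fun p => π '' invariantNhd σ A p)
    (fun p => by
      rw [← (isQuotientMap_quotient_mk' (s := MulAction.orbitRel Γ _)).isOpen_preimage]
      exact (hpre p).symm ▸ isOpen_invariantNhd hσ A p)
    (by
      rintro ⟨p⟩ -
      exact Set.mem_iUnion.mpr ⟨p, p, mem_invariantNhd_self p, rfl⟩)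
  let Kof : ExtendedHalfPlane Γ → Set ℍ := Sum.elim (fun p => Metric.closedBall p 1) fun _ => ∅
  let Rof : ExtendedHalfPlane Γ → Set (OnePoint ℝ) := Sum.elim (fun _ => ∅) fun d => {(cuspRep d).1}
  refine ⟨⋃ p ∈ t, Rof p, ⋃ p ∈ t, Kof p, ?_, ?_, ?_, ?_, ?_⟩
  · refine t.finite_toSet.biUnion fun p _ => ?_
    rcases p with p | d
    exacts [Set.finite_empty, Set.finite_singleton _]
  · refine t.isCompact_biUnion fun p _ => ?_
    rcases p with p | d
    exacts [isCompact_closedBall _ _, isCompact_empty]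
  · intro c hc
    simp only [Set.mem_iUnion] at hc
    obtain ⟨p | d, -, hc⟩ := hc
    · exact hc.elim
    · rw [show c = _ from hc]
      exact (cuspRep d).2
  · intro c hc c' hc' δ hδ hcc
    simp only [Set.mem_iUnion] at hc hc'
    obtain ⟨p | d, -, hc⟩ := hc
    · exact hc.elim
    obtain ⟨p | d', -, hc'⟩ := hc'
    · exact hc'.elim
    obtain rfl : c = _ := hc
    obtain rfl : c' = _ := hc'
    -- All cusps in the cover are chosen representatives, so two equivalent ones coincide.
    have hrep (e : cuspsSubMulAction Γ) : cuspRep (cuspRep e) = cuspRep e := by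
      obtain ⟨γ, hγ⟩ := exists_smul_cuspRep e
      conv_lhs => rw [← hγ, cuspRep_smul]
    have hex : ∃ γ : Γ, γ • cuspRep d = cuspRep d' := by
      rcases hδ with h | h
      · exact ⟨⟨δ, h⟩, Subtype.ext hcc⟩
      · exact ⟨⟨-δ, h⟩, Subtype.ext ((neg_smul_onePoint δ _).trans hcc)⟩
    obtain ⟨γ, hγ⟩ := hex
    rw [← hrep d, ← hrep d', ← hγ, cuspRep_smul]
  · intro z
    have hz := ht (Set.mem_univ (π (ofPoint z)))
    simp only [Set.mem_iUnion] at hz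
    obtain ⟨p, hp, hz⟩ := hz
    have hz' : ofPoint z ∈ invariantNhd σ A p := (hpre p).subset hz
    rcases p with p | d
    · obtain ⟨γ, hγ⟩ := hz'
      exact ⟨γ.1, Γ.le_adjoinNegOne γ.2, .inl (Set.mem_biUnion hp hγ.le)⟩
    · obtain ⟨γ, hγ⟩ := hz'
      exact ⟨γ.1, Γ.le_adjoinNegOne γ.2, .inr ⟨_, Set.mem_biUnion hp rfl, hγ⟩⟩

end Cover

end

/-! ### Fundamental sets and words of logarithmic length -/

noncomputable section

open ExtendedHalfPlane

section Reduction

variable {Γ : Subgroup (GL (Fin 2) ℝ)}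

theorem IsScalingMatrix.exists_smul_re_mem_Icc {c : OnePoint ℝ} {σ : GL (Fin 2) ℝ}
    (hσ : IsScalingMatrix Γ c σ) (z : ℍ) : ∃ p ∈ Γ.adjoinNegOne, p • c = c ∧
      (σ⁻¹ • p • z).re ∈ Set.Icc (0 : ℝ) 1 ∧ (σ⁻¹ • p • z).im = (σ⁻¹ • z).im := by
  set m : ℤ := ⌊(σ⁻¹ • z).re⌋
  obtain ⟨h1, h2⟩ := hσ.conj_upperRightHom_mem (-m)
  refine ⟨_, h1, h2, ?_, hσ.im_inv_smul_smul h1 h2 z⟩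
  have h3 : σ⁻¹ • (σ * upperRightHom ((-m : ℤ) : ℝ) * σ⁻¹) • z
      = upperRightHom ((-m : ℤ) : ℝ) • σ⁻¹ • z := by simp [mul_smul]
  rw [h3, ← coe_re, coe_upperRightHom_smul]
  have h4 := Int.floor_le (σ⁻¹ • z).re
  have h5 := Int.lt_floor_add_one (σ⁻¹ • z).re
  constructor <;> simp <;> linarith

/-- A compact set has bounded height in a cusp, uniformly over its translates. -/
theorem IsScalingMatrix.exists_im_inv_smul_smul_le (hΓ : IsFuchsianFirstKind Γ) {c : OnePoint ℝ}
    {σ : GL (Fin 2) ℝ} (hσ : IsScalingMatrix Γ c σ) {K : Set ℍ} (hK : IsCompact K) :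
    ∃ M : ℝ, ∀ w ∈ K, ∀ δ ∈ Γ.adjoinNegOne, (σ⁻¹ • δ • w).im ≤ M := by
  -- With `y` the height of `w`, the height of `δ w` is `y` if `δ` fixes the cusp and at most `1 /
  -- y` otherwise; `y + 1 / y` dominates both.
  have hcont : Continuous fun w : ℍ => (σ⁻¹ • w).im + (σ⁻¹ • w).im⁻¹ := by
    have h : Continuous fun w : ℍ => (σ⁻¹ • w).im :=
      continuous_im.comp (continuous_const_smul σ⁻¹)
    exact h.add (h.inv₀ fun w => (σ⁻¹ • w).im_ne_zero)
  obtain ⟨M, hM⟩ := hK.bddAbove_image hcont.continuousOn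
  refine ⟨M, fun w hw δ hδ => ?_⟩
  have hMw := hM (Set.mem_image_of_mem _ hw)
  have h0 := (σ⁻¹ • w).im_pos
  have h1 := inv_pos.mpr h0
  by_cases hc : δ • c = c
  · rw [hσ.im_inv_smul_smul hδ hc]; linarith
  · have := IsScalingMatrix.im_mul_im_le_one hΓ hσ hσ hδ hc w
    rw [← le_div_iff₀ h0, one_div] at this
    linarith

/-- A set `F` that meets every orbit, bounded up to finitely many cusps, such that the elements of
the group that move a point of `F` to a bounded distance from `F` either lie in a finite set or fix
a cusp. -/
theorem exists_reduction (hΓ : IsFuchsianFirstKind Γ) {σ : OnePoint ℝ → GL (Fin 2) ℝ}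
    (hσ : ∀ c, IsCusp c Γ → IsScalingMatrix Γ c (σ c)) {K₀ : Set ℍ} (hK₀ : IsCompact K₀) :
    ∃ (F K : Set ℍ) (R : Set (OnePoint ℝ)) (S : Set (GL (Fin 2) ℝ)), K₀ ⊆ F ∧ S.Finite ∧
      (∀ δ ∈ S, δ⁻¹ ∈ S) ∧ (∀ z, ∃ u ∈ Γ.adjoinNegOne, u • z ∈ F) ∧
      (∀ w ∈ F, ∀ w' ∈ F, ∀ δ ∈ Γ.adjoinNegOne, dist (δ • w) w' ≤ 1 →
        δ ∈ S ∨ ∃ c, IsCusp c Γ ∧ δ • c = c) ∧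
      IsCompact K ∧ R.Finite ∧ (∀ c ∈ R, IsCusp c Γ) ∧
      ∀ w ∈ F, w ∈ K ∨ ∃ c ∈ R, ((σ c)⁻¹ • w).re ∈ Set.Icc (0 : ℝ) 1 ∧ 1 ≤ ((σ c)⁻¹ • w).im := by
  have := hΓ.discreteTopology_adjoinNegOne
  obtain ⟨R, K₁, hR, hK₁, hRc, hRi, hcov⟩ := exists_compact_cover hΓ hσ 3
  set K := K₀ ∪ K₁
  have hK : IsCompact K := hK₀.union hK₁
  choose! M₁ hM₁ using fun c (hc : c ∈ R) => (hσ c (hRc c hc)).exists_im_inv_smul_smul_le hΓ hK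
  obtain ⟨M₂, hM₂⟩ := (hR.image M₁).bddAbove
  set M := max M₂ 1
  have hM (c) (hc : c ∈ R) (w) (hw : w ∈ K) (δ) (hδ : δ ∈ Γ.adjoinNegOne) :
      ((σ c)⁻¹ • δ • w).im ≤ M :=
    (hM₁ c hc w hw δ hδ).trans ((hM₂ ⟨c, hc, rfl⟩).trans (le_max_left _ _))
  have hM1 : 1 ≤ M := le_max_right _ _
  set e := Real.exp 1
  have he : 1 ≤ e := Real.one_le_exp zero_le_one
  have he3 : e < 3 := Real.exp_one_lt_d9.trans (by norm_num)
  have him (c) (hc : c ∈ R) (w w' : ℍ) (h : dist w w' ≤ 1) :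
      ((σ c)⁻¹ • w).im ≤ ((σ c)⁻¹ • w').im * e := by
    refine (im_le_im_mul_exp_dist _ ((σ c)⁻¹ • w')).trans ?_
    rw [dist_smul_smul_of_det_eq_one (by simp [(hσ c (hRc c hc)).det_eq_one])]
    have := ((σ c)⁻¹ • w').im_pos
    gcongr
    exact Real.exp_le_exp.mpr h
  set B : OnePoint ℝ → Set ℍ :=
    fun c => {w | ((σ c)⁻¹ • w).re ∈ Set.Icc (0 : ℝ) 1 ∧ 3 < ((σ c)⁻¹ • w).im} with hB
  set F := K ∪ ⋃ c ∈ R, B c with hF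
  -- The strips are cut at height `M e`; the lower parts join the compact set. Here `M` bounds the
  -- heights of all translates of `K`, and `e` is the largest factor by which a height changes over
  -- distance `1`.
  set K' := K ∪ ⋃ c ∈ R, (fun v => σ c • v) ''
    {v : ℍ | v.re ∈ Set.Icc (0 : ℝ) 1 ∧ v.im ∈ Set.Icc 3 (M * e)} with hK'def
  have hK' : IsCompact K' := hK.union (hR.isCompact_biUnion fun c _ =>
    (isCompact_setOf_re_im_mem_Icc (by norm_num)).image (continuous_const_smul (σ c)))
  have hdeep (w) (hw : w ∈ F) : w ∈ K' ∨ ∃ c ∈ R, M * e < ((σ c)⁻¹ • w).im := by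
    rcases hw with hw | hw
    · exact .inl (.inl hw)
    · simp only [Set.mem_iUnion] at hw
      obtain ⟨c, hc, hw1, hw2⟩ := hw
      rcases lt_or_ge (M * e) ((σ c)⁻¹ • w).im with h | h
      · exact .inr ⟨c, hc, h⟩
      · exact .inl (.inr (Set.mem_biUnion hc ⟨(σ c)⁻¹ • w, ⟨hw1, hw2.le, h⟩, by simp⟩))
  -- A point above height `M e` in `c` is too high to be moved near `K`. If it is moved near the
  -- strip of `c'` with `δ c ≠ c'`, the product of its two heights exceeds `1`; if `δ c = c'`,
  -- inequivalence gives `c = c'`.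
  have hclaim (w w' : ℍ) (hw' : w' ∈ F) (δ) (hδ : δ ∈ Γ.adjoinNegOne) (hd : dist (δ • w) w' ≤ 1)
      (c) (hc : c ∈ R) (hw : M * e < ((σ c)⁻¹ • w).im) : δ • c = c := by
    rcases hw' with hw' | hw'
    · exfalso
      have h1 := him c hc w (δ⁻¹ • w') (by
        rwa [← dist_smul_smul_of_det_eq_one (hΓ.det_eq_one δ hδ), smul_inv_smul])
      have h2 := hM c hc w' hw' δ⁻¹ (inv_mem hδ)
      have : ((σ c)⁻¹ • δ⁻¹ • w').im * e ≤ M * e := by gcongr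
      linarith
    · simp only [Set.mem_iUnion] at hw'
      obtain ⟨c', hc', -, hw2⟩ := hw'
      by_contra hne
      have hne' : δ • c ≠ c' := by
        intro h
        have h' := hRi c hc c' hc' δ hδ h
        rw [← h'] at h
        exact hne h
      have h1 := IsScalingMatrix.im_mul_im_le_one hΓ (hσ c (hRc c hc)) (hσ c' (hRc c' hc')) hδ
        hne' w
      have h2 := him c' hc' w' (δ • w) (by rwa [dist_comm])
      have h3 := ((σ c')⁻¹ • δ • w).im_pos
      have h4 : ((σ c')⁻¹ • δ • w).im * e ≤ ((σ c')⁻¹ • δ • w).im * ((σ c)⁻¹ • w).im := by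
        gcongr
        nlinarith
      linarith
  -- Finite by proper discontinuity; the thickening accounts for the tolerance `1` in the distance.
  set S₀ := {δ ∈ Γ.adjoinNegOne | ∃ w ∈ K', δ • w ∈ Metric.cthickening 1 K'}
  have hS₀ : S₀.Finite := finite_setOf_smul_mem hΓ.det_eq_one hK' hK'.cthickening
  refine ⟨F, K, R, S₀ ∪ S₀⁻¹, fun w hw => .inl (.inl hw), hS₀.union hS₀.inv, ?_, ?_, ?_,
    hK, hR, hRc, ?_⟩
  · rintro δ (h | h)
    · exact .inr (by simpa using h)
    · exact .inl h
  · intro z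
    obtain ⟨γ, hγ, h | ⟨c, hc, h⟩⟩ := hcov z
    · exact ⟨γ, hγ, .inl (.inr h)⟩
    · obtain ⟨p, hp, -, hp1, hp2⟩ := (hσ c (hRc c hc)).exists_smul_re_mem_Icc (γ • z)
      refine ⟨p * γ, mul_mem hp hγ, .inr (Set.mem_biUnion hc ?_)⟩
      rw [mul_smul]
      exact ⟨hp1, hp2 ▸ h⟩
  · intro w hw w' hw' δ hδ hd
    rcases hdeep w hw with h1 | ⟨c, hc, h1⟩
    · rcases hdeep w' hw' with h2 | ⟨c, hc, h2⟩
      · exact .inl (.inl ⟨hδ, w, h1, Metric.mem_cthickening_of_dist_le _ w' _ _ h2 hd⟩)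
      · refine .inr ⟨c, hRc c hc, ?_⟩
        have := hclaim w' w hw δ⁻¹ (inv_mem hδ) (by
          rwa [← dist_smul_smul_of_det_eq_one (hΓ.det_eq_one δ hδ), smul_inv_smul, dist_comm])
          c hc h2
        rw [inv_smul_eq_iff] at this
        exact this.symm
    · exact .inr ⟨c, hRc c hc, hclaim w w' hw' δ hδ hd c hc h1⟩
  · rintro w (hw | hw)
    · exact .inl hw
    · simp only [Set.mem_iUnion] at hw
      obtain ⟨c, hc, hw1, hw2⟩ := hw
      exact .inr ⟨c, hc, hw1, by linarith⟩

/-- The elements of a finite set `S`, and those that fix a cusp. -/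
def letters (Γ : Subgroup (GL (Fin 2) ℝ)) (S : Set (GL (Fin 2) ℝ)) : Set (GL (Fin 2) ℝ) :=
  {δ ∈ Γ.adjoinNegOne | δ ∈ S ∨ ∃ c, IsCusp c Γ ∧ δ • c = c}

open Pointwise in
theorem letters_inv_pow {S : Set (GL (Fin 2) ℝ)} (hS : ∀ δ ∈ S, δ⁻¹ ∈ S) {n : ℕ}
    {γ : GL (Fin 2) ℝ} (hγ : γ ∈ letters Γ S ^ n) : γ⁻¹ ∈ letters Γ S ^ n := by
  have h : (letters Γ S)⁻¹ = letters Γ S := by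
    have hsub : ∀ δ ∈ letters Γ S, δ⁻¹ ∈ letters Γ S := by
      rintro δ ⟨h1, h2 | ⟨c, hc, h2⟩⟩
      · exact ⟨inv_mem h1, .inl (hS δ h2)⟩
      · exact ⟨inv_mem h1, .inr ⟨c, hc, by rw [inv_smul_eq_iff, h2]⟩⟩
    ext δ
    exact ⟨fun h => by simpa using hsub _ h, hsub δ⟩
  rw [← h, inv_pow]
  simpa using hγ

open Pointwise in
theorem letters_pow_subset {S : Set (GL (Fin 2) ℝ)} {n : ℕ} :
    letters Γ S ^ n ⊆ Γ.adjoinNegOne := by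
  induction n with
  | zero => simp
  | succ n ih =>
    rw [pow_succ]
    rintro _ ⟨a, ha, b, hb, rfl⟩
    exact mul_mem (ih ha) hb.1

open Pointwise in
/-- Every point is moved into `F` by a word whose length is at most logarithmic in the height. -/
theorem exists_mem_letters_pow_smul_mem {c : OnePoint ℝ} {σ : GL (Fin 2) ℝ} (hc : IsCusp c Γ)
    (hσ : IsScalingMatrix Γ c σ) {F : Set ℍ} {S : Set (GL (Fin 2) ℝ)}
    (hF : (fun v => σ • v) '' {v : ℍ | v.re ∈ Set.Icc (0 : ℝ) 1 ∧ v.im ∈ Set.Icc 1 1} ⊆ F)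
    (hdet : ∀ g ∈ Γ.adjoinNegOne, g.det = 1)
    (hred : ∀ z, ∃ u ∈ Γ.adjoinNegOne, u • z ∈ F)
    (hS : ∀ w ∈ F, ∀ w' ∈ F, ∀ δ ∈ Γ.adjoinNegOne, dist (δ • w) w' ≤ 1 →
        δ ∈ S ∨ ∃ c, IsCusp c Γ ∧ δ • c = c) (z : ℍ) :
    ∃ u ∈ letters Γ S ^ (⌈|Real.log (σ⁻¹ • z).im|⌉₊ + 1), u • z ∈ F := by
  -- Walk from `x + i` to `x + i e^s` in `n` equal steps of hyperbolic length `|s| / n ≤ 1`.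
  have key (x : ℝ) (hx : x ∈ Set.Icc (0 : ℝ) 1) (n : ℕ) : ∀ s : ℝ, |s| ≤ n →
      ∃ u ∈ letters Γ S ^ n, u • σ • (⟨⟨x, Real.exp s⟩, Real.exp_pos s⟩ : ℍ) ∈ F := by
    induction n with
    | zero =>
      intro s hs
      have hs0 : s = 0 := abs_nonpos_iff.mp (by simpa using hs)
      refine ⟨1, by simp, hF ⟨_, ⟨?_, ?_⟩, (one_smul _ _).symm⟩⟩
      · exact hx
      · simp [hs0, UpperHalfPlane.im]
    | succ n ih =>
      intro s hs
      have hn : (0 : ℝ) < n + 1 := by positivity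
      push_cast at hs
      -- The penultimate point of the walk. Its reduction and that of the endpoint differ by `u
      -- u'⁻¹`, which moves a point of `F` to within `1` of `F` and is therefore a letter.
      obtain ⟨u', hu', hF'⟩ := ih (s * (n / (n + 1))) (by
        rw [abs_mul, abs_of_nonneg (a := (n / (n + 1) : ℝ)) (by positivity),
          ← mul_div_assoc, div_le_iff₀ hn, mul_comm]
        gcongr)
      obtain ⟨u, hu, hF⟩ := hred (σ • (⟨⟨x, Real.exp s⟩, Real.exp_pos s⟩ : ℍ))
      have huu : u * u'⁻¹ ∈ Γ.adjoinNegOne := mul_mem hu (inv_mem (letters_pow_subset hu'))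
      refine ⟨u, ?_, hF⟩
      rw [pow_succ']
      refine ⟨u * u'⁻¹, ⟨huu, hS _ hF' _ hF _ huu ?_⟩, u', hu', by simp⟩
      rw [mul_smul, inv_smul_smul, dist_smul_smul_of_det_eq_one (hdet u hu),
        dist_smul_smul_of_det_eq_one hσ.det_eq_one]
      refine (dist_of_re_eq (by rfl)).trans_le ?_
      simp only [UpperHalfPlane.im, Real.log_exp, Real.dist_eq]
      have : s * (n / (n + 1)) - s = -(s / (n + 1)) := by field_simp; ring
      rw [this, abs_neg, abs_div, abs_of_pos hn, div_le_one hn]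
      exact hs
  -- The translation `p` into the strip fixes `c`, hence is one further letter: the `+ 1` in the
  -- length.
  obtain ⟨p, hp, hpc, hre, him⟩ := hσ.exists_smul_re_mem_Icc z
  obtain ⟨u, hu, hF⟩ := key _ hre _ _ (Nat.le_ceil |Real.log (σ⁻¹ • z).im|)
  have hz : σ • (⟨⟨(σ⁻¹ • p • z).re, Real.exp (Real.log (σ⁻¹ • z).im)⟩, Real.exp_pos _⟩ : ℍ)
      = p • z := by
    rw [smul_eq_iff_eq_inv_smul]
    ext
    apply Complex.ext
    · rfl
    · simp only [Real.exp_log (σ⁻¹ • z).im_pos]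
      exact him.symm
  rw [hz] at hF
  refine ⟨u * p, ?_, by rwa [mul_smul]⟩
  rw [pow_succ]
  exact ⟨u, hu, p, ⟨hp, .inr ⟨c, hc, hpc⟩⟩, rfl⟩

end Reduction

end

noncomputable section

open ExtendedHalfPlane

/-! ### Growth of cusp forms of higher order along words -/

theorem slash_two_neg (f : ℍ → ℂ) (g : GL (Fin 2) ℝ) : f ∣[(2 : ℤ)] (-g) = f ∣[(2 : ℤ)] g := by
  ext z
  simp only [ModularForm.slash_apply, σ_neg, UpperHalfPlane.neg_smul, denom_neg]
  have : (-g).det.val = g.det.val := by simp [Matrix.det_neg]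
  rw [this, Even.neg_zpow (by decide)]

theorem slash_two_apply {g : GL (Fin 2) ℝ} (hg : g.det = 1) (f : ℍ → ℂ) (z : ℍ) :
    (f ∣[(2 : ℤ)] g) z = f (g • z) / denom g z ^ 2 := by
  have hd : (g.det.val : ℝ) = 1 := by rw [hg]; rfl
  rw [ModularForm.slash_apply, UpperHalfPlane.σ, hd]
  simp [div_eq_mul_inv, _root_.zpow_neg]

theorem im_mul_norm_slash_two {g : GL (Fin 2) ℝ} (hg : g.det = 1) (f : ℍ → ℂ) (z : ℍ) :
    z.im * ‖(f ∣[(2 : ℤ)] g) z‖ = (g • z).im * ‖f (g • z)‖ := by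
  have hd : (g.det.val : ℝ) = 1 := by rw [hg]; rfl
  rw [slash_two_apply hg, im_smul_eq_div_normSq, hd, norm_div, norm_pow,
    Complex.normSq_eq_norm_sq, abs_one, one_mul]
  ring

section Forms

variable {Γ : Subgroup (GL (Fin 2) ℝ)}

theorem mdifferentiable_of_mem_higherCuspForms {k : ℤ} {t : ℕ} {f : ℍ → ℂ}
    (hf : f ∈ higherCuspForms Γ k t) : MDiff f := by
  cases t with
  | zero =>
    rw [show f = 0 from hf]
    exact mdifferentiable_const
  | succ t => exact hf.1

theorem zero_mem_higherCuspForms {k : ℤ} (t : ℕ) : (0 : ℍ → ℂ) ∈ higherCuspForms Γ k t := by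
  induction t with
  | zero => rfl
  | succ t ih =>
    refine ⟨mdifferentiable_const, fun γ _ => by simpa using ih, fun π _ _ => by simp,
      fun c _ σ _ => ⟨1, one_pos, ?_⟩⟩
    rw [SlashAction.zero_slash]
    exact Asymptotics.isBigO_zero _ _

theorem higherCuspForms_subset_succ {k : ℤ} (t : ℕ) :
    higherCuspForms Γ k t ⊆ higherCuspForms Γ k (t + 1) := by
  induction t with
  | zero =>
    intro f hf
    rw [show f = 0 from hf]
    exact zero_mem_higherCuspForms 1
  | succ t ih => exact fun f hf => ⟨hf.1, fun γ hγ => ih (hf.2.1 γ hγ), hf.2.2⟩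

theorem add_mem_higherCuspForms {k : ℤ} {t : ℕ} {f g : ℍ → ℂ} (hf : f ∈ higherCuspForms Γ k t)
    (hg : g ∈ higherCuspForms Γ k t) : f + g ∈ higherCuspForms Γ k t := by
  induction t generalizing f g with
  | zero =>
    rw [show f = 0 from hf, show g = 0 from hg, add_zero]
    rfl
  | succ t ih =>
    refine ⟨hf.1.add hg.1, fun γ hγ => ?_, fun π hπ hp => ?_, fun c hc σ hσ => ?_⟩
    · rw [SlashAction.add_slash, add_sub_add_comm]
      exact ih (hf.2.1 γ hγ) (hg.2.1 γ hγ)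
    · rw [SlashAction.add_slash, hf.2.2.1 π hπ hp, hg.2.2.1 π hπ hp]
    · obtain ⟨a, ha, h1⟩ := hf.2.2.2 c hc σ hσ
      obtain ⟨b, hb, h2⟩ := hg.2.2.2 c hc σ hσ
      have hmono {x : ℝ} (hx : min a b ≤ x) : (fun z : ℍ => Real.exp (-x * z.im)) =O[atImInfty]
          fun z : ℍ => Real.exp (-min a b * z.im) := by
        refine Asymptotics.isBigO_of_le _ fun z => ?_
        rw [Real.norm_of_nonneg (Real.exp_pos _).le, Real.norm_of_nonneg (Real.exp_pos _).le]
        have := z.im_pos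
        exact Real.exp_le_exp.mpr (by nlinarith)
      refine ⟨min a b, lt_min ha hb, ?_⟩
      rw [SlashAction.add_slash]
      exact (h1.trans (hmono (min_le_left _ _))).add (h2.trans (hmono (min_le_right _ _)))

theorem slash_sub_mem_higherCuspForms {t : ℕ} {f : ℍ → ℂ} (hf : f ∈ higherCuspForms Γ 2 (t + 1))
    {γ : GL (Fin 2) ℝ} (hγ : γ ∈ Γ.adjoinNegOne) :
    f ∣[(2 : ℤ)] γ - f ∈ higherCuspForms Γ 2 t := by
  rcases hγ with h | h
  · exact hf.2.1 γ h
  · rw [← slash_two_neg]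
    exact hf.2.1 _ h

theorem slash_mem_higherCuspForms {t : ℕ} {f : ℍ → ℂ} (hf : f ∈ higherCuspForms Γ 2 t)
    {γ : GL (Fin 2) ℝ} (hγ : γ ∈ Γ.adjoinNegOne) : f ∣[(2 : ℤ)] γ ∈ higherCuspForms Γ 2 t := by
  cases t with
  | zero =>
    rw [show f = 0 from hf, SlashAction.zero_slash]
    rfl
  | succ t =>
    rw [← sub_add_cancel (f ∣[(2 : ℤ)] γ) f]
    exact add_mem_higherCuspForms
      (higherCuspForms_subset_succ t (slash_sub_mem_higherCuspForms hf hγ)) hf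

/-- An element fixing a cusp is conjugate to plus or minus a translation: it is `±1` or parabolic.
The sign is harmless in even weight. -/
theorem slash_eq_of_smul_cusp_eq (hΓ : IsFuchsianFirstKind Γ) {t : ℕ} {f : ℍ → ℂ}
    (hf : f ∈ higherCuspForms Γ 2 t) {γ : GL (Fin 2) ℝ} (hγ : γ ∈ Γ.adjoinNegOne)
    {c : OnePoint ℝ} (hc : IsCusp c Γ) (hγc : γ • c = c) : f ∣[(2 : ℤ)] γ = f := by
  cases t with
  | zero => rw [show f = 0 from hf, SlashAction.zero_slash]
  | succ t =>
    obtain ⟨σ, hσ⟩ := exists_isScalingMatrix hΓ hc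
    obtain ⟨m, hm⟩ := (hσ.stabilizer γ).mp ⟨hγ, hγc⟩
    by_cases hm0 : m = 0
    · have hone (x : GL (Fin 2) ℝ) (hx : σ⁻¹ * γ * σ = x) : γ = σ * x * σ⁻¹ := by
        rw [← hx]; group
      rcases hm with hm | hm <;> rw [hone _ hm, hm0]
      · simp
      · simp [slash_two_neg]
    · have hp : γ.IsParabolic := by
        rw [← isParabolic_conj_iff' σ]
        have hm0' : (m : ℝ) ≠ 0 := by exact_mod_cast hm0
        rcases hm with hm | hm <;> rw [hm]
        · rw [GeneralLinearGroup.isParabolic_iff_of_upperTriangular (by simp [upperRightHom_apply])]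
          simpa [upperRightHom_apply] using hm0
        · rw [GeneralLinearGroup.isParabolic_iff_of_upperTriangular (by simp [upperRightHom_apply])]
          simpa [upperRightHom_apply] using hm0
      rcases hγ with h | h
      · exact hf.2.2.1 γ h hp
      · rw [← slash_two_neg]
        exact hf.2.2.1 _ h (by
          rw [GeneralLinearGroup.IsParabolic, Units.val_neg]; exact hp.neg)

open Pointwise in
/-- Bounds for subadditive functionals on the spaces of cusp forms of higher order persist, with
polynomial loss, along words in the letters. -/
theorem exists_bound_slash_letters_pow (hΓ : IsFuchsianFirstKind Γ) {S : Set (GL (Fin 2) ℝ)}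
    (hS : S.Finite) {ι : Type*} (P : ι → (ℍ → ℂ) → ℝ) (b : ι → ℝ) (hb : ∀ i, 1 ≤ b i) (e : ℕ)
    (hadd : ∀ i t f g, f ∈ higherCuspForms Γ 2 t → g ∈ higherCuspForms Γ 2 t →
      P i (f + g) ≤ P i f + P i g)
    (hP : ∀ t, ∀ f ∈ higherCuspForms Γ 2 (t + 1), ∃ C, ∀ i, P i f ≤ C * b i ^ (t + e)) (t : ℕ) :
    ∀ f ∈ higherCuspForms Γ 2 (t + 1), ∃ C, 0 ≤ C ∧ ∀ i (n : ℕ), ∀ γ ∈ letters Γ S ^ n,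
      P i (f ∣[(2 : ℤ)] γ) ≤ C * (b i + n) ^ (t + e) := by
  induction t with
  | zero =>
    intro f hf
    obtain ⟨C, hC⟩ := hP 0 f hf
    refine ⟨max C 0, le_max_right _ _, fun i n γ hγ => ?_⟩
    -- Forms of order one are invariant, so the word plays no role.
    have h0 : f ∣[(2 : ℤ)] γ = f :=
      sub_eq_zero.mp (slash_sub_mem_higherCuspForms hf (letters_pow_subset hγ))
    have := hb i
    rw [h0]
    refine (hC i).trans (mul_le_mul (le_max_left _ _) ?_ (by positivity) (le_max_right _ _))
    gcongr
    exact le_add_of_nonneg_right (Nat.cast_nonneg n)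
  | succ t ih =>
    intro f hf
    obtain ⟨C, hC⟩ := hP (t + 1) f hf
    have hex (δ : GL (Fin 2) ℝ) : ∃ C, 0 ≤ C ∧ (δ ∈ Γ.adjoinNegOne → ∀ i (n : ℕ), ∀ γ ∈ letters Γ S ^ n,
        P i ((f ∣[(2 : ℤ)] δ - f) ∣[(2 : ℤ)] γ) ≤ C * (b i + n) ^ (t + e)) := by
      by_cases hδ : δ ∈ Γ.adjoinNegOne
      · obtain ⟨C, h0, h⟩ := ih _ (slash_sub_mem_higherCuspForms hf hδ)
        exact ⟨C, h0, fun _ => h⟩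
      · exact ⟨0, le_rfl, fun h => absurd h hδ⟩
    choose D hD0 hD using hex
    -- Finiteness of `S` makes the constants for the lower order forms `f|(δ - 1)` uniform; letters
    -- fixing a cusp need no constant.
    obtain ⟨M, hM⟩ := (hS.image D).bddAbove
    set M' := max M 0
    have hM' : ∀ δ ∈ S, D δ ≤ M' := fun δ hδ => (hM ⟨δ, hδ, rfl⟩).trans (le_max_left _ _)
    have hM0 : 0 ≤ M' := le_max_right _ _
    set C' := max C 0
    have hC0 : 0 ≤ C' := le_max_right _ _
    -- Peel off letters from the left: each letter of `S` adds one lower order term, and a letter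
    -- fixing a cusp adds nothing. The factor `n` is later absorbed as one more power of `b i + n`.
    have key (i : ι) (n : ℕ) : ∀ γ ∈ letters Γ S ^ n, P i (f ∣[(2 : ℤ)] γ) ≤
        C' * b i ^ (t + 1 + e) + n * (M' * (b i + n) ^ (t + e)) := by
      have hbi := hb i
      induction n with
      | zero =>
        intro γ hγ
        rw [pow_zero, Set.mem_one] at hγ
        rw [hγ, SlashAction.slash_one, Nat.cast_zero, zero_mul, add_zero]
        exact (hC i).trans (mul_le_mul_of_nonneg_right (le_max_left _ _) (by positivity))
      | succ n ihn =>
        intro γ hγ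
        rw [pow_succ'] at hγ
        obtain ⟨δ, ⟨hδ, hδ'⟩, γ', hγ', rfl⟩ := hγ
        have h1 := ihn γ' hγ'
        have hmono : (b i + n) ^ (t + e) ≤ (b i + (n + 1 : ℕ)) ^ (t + e) := by
          gcongr
          exact n.le_succ
        have h2 : P i (f ∣[(2 : ℤ)] (δ * γ')) ≤
            P i (f ∣[(2 : ℤ)] γ') + M' * (b i + n) ^ (t + e) := by
          rcases hδ' with hδS | ⟨c, hc, hδc⟩
          · have hsplit : f ∣[(2 : ℤ)] (δ * γ') =
                f ∣[(2 : ℤ)] γ' + (f ∣[(2 : ℤ)] δ - f) ∣[(2 : ℤ)] γ' := by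
              rw [SlashAction.slash_mul, ← SlashAction.add_slash, add_sub_cancel]
            rw [hsplit]
            have hγG := letters_pow_subset hγ'
            refine (hadd i (t + 2) _ _ (slash_mem_higherCuspForms hf hγG)
              (slash_mem_higherCuspForms (higherCuspForms_subset_succ _
                (slash_sub_mem_higherCuspForms hf hδ)) hγG)).trans ?_
            gcongr
            refine (hD δ hδ i n γ' hγ').trans ?_
            gcongr
            exact hM' δ hδS
          · rw [SlashAction.slash_mul, slash_eq_of_smul_cusp_eq hΓ hf hδ hc hδc]
            exact le_add_of_nonneg_right (by positivity)
        have h3 : n * (M' * (b i + n) ^ (t + e)) ≤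
            n * (M' * (b i + (n + 1 : ℕ)) ^ (t + e)) := by gcongr
        have h4 : M' * (b i + n) ^ (t + e) ≤ M' * (b i + (n + 1 : ℕ)) ^ (t + e) := by
          gcongr
        push_cast at h3 h4 ⊢
        linarith
    refine ⟨C' + M', by positivity, fun i n γ hγ => (key i n γ hγ).trans ?_⟩
    have hbi := hb i
    have h1 : b i ^ (t + 1 + e) ≤ (b i + n) ^ (t + 1 + e) := by
      gcongr; exact le_add_of_nonneg_right (Nat.cast_nonneg n)
    have h2 : n * (M' * (b i + n) ^ (t + e)) ≤ M' * (b i + n) ^ (t + 1 + e) := by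
      rw [show t + 1 + e = t + e + 1 by ring, pow_succ]
      have : (n : ℝ) ≤ b i + n := by linarith
      calc n * (M' * (b i + n) ^ (t + e)) ≤ (b i + n) * (M' * (b i + n) ^ (t + e)) := by gcongr
        _ = _ := by ring
    have h3 : C' * b i ^ (t + 1 + e) ≤ C' * (b i + n) ^ (t + 1 + e) := by gcongr
    linarith

end Forms

end

noncomputable section

open ExtendedHalfPlane

/-! ### Pointwise bounds -/

/-- Exponential decay enters only as decay like `y⁻²`, which suffices for boundedness on `F` and
convergence at the cusps. Below the height where the decay starts, the strip is compact. -/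
theorem exists_im_sq_mul_norm_le {g : ℍ → ℂ} (hg : Continuous g) {a : ℝ} (ha : 0 < a)
    (hO : g =O[atImInfty] fun z : ℍ => Real.exp (-a * z.im)) :
    ∃ C : ℝ, ∀ z : ℍ, z.re ∈ Set.Icc (0 : ℝ) 1 → 1 ≤ z.im → z.im ^ 2 * ‖g z‖ ≤ C := by
  obtain ⟨c, hc⟩ := hO.bound
  obtain ⟨A, hA⟩ := (atImInfty_mem _).mp hc
  have hcont : Continuous fun z : ℍ => z.im ^ 2 * ‖g z‖ := (continuous_im.pow 2).mul hg.norm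
  obtain ⟨M, hM⟩ := (isCompact_setOf_re_im_mem_Icc (a := 1) (b := A) (x := 0) (y := 1)
    one_pos).bddAbove_image hcont.continuousOn
  refine ⟨max M (|c| * (2 / a ^ 2)), fun z hre him => ?_⟩
  rcases le_total A z.im with h | h
  · refine le_trans ?_ (le_max_right _ _)
    have h1 : ‖g z‖ ≤ c * ‖Real.exp (-a * z.im)‖ := hA z h
    rw [Real.norm_of_nonneg (Real.exp_pos _).le] at h1
    have h2 : z.im ^ 2 * Real.exp (-a * z.im) ≤ 2 / a ^ 2 := by
      have h3 := Real.quadratic_le_exp_of_nonneg (x := a * z.im) (by positivity)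
      rw [neg_mul, Real.exp_neg, ← div_eq_mul_inv, div_le_div_iff₀ (Real.exp_pos _) (by positivity)]
      have : 0 < a * z.im := by positivity
      nlinarith
    calc z.im ^ 2 * ‖g z‖ ≤ z.im ^ 2 * (|c| * Real.exp (-a * z.im)) := by
          gcongr; exact h1.trans (by gcongr; exact le_abs_self c)
      _ = |c| * (z.im ^ 2 * Real.exp (-a * z.im)) := by ring
      _ ≤ _ := by gcongr
  · exact (hM ⟨z, ⟨hre, him, h⟩, rfl⟩).trans (le_max_left _ _)

theorem continuous_slash_two {g : GL (Fin 2) ℝ} (hg : g.det = 1) {f : ℍ → ℂ} (hf : Continuous f) :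
    Continuous (f ∣[(2 : ℤ)] g) := by
  have : f ∣[(2 : ℤ)] g = fun z : ℍ => f (g • z) / denom g z ^ 2 := funext (slash_two_apply hg f)
  rw [this]
  refine (hf.comp (continuous_const_smul g)).div ?_ fun z => pow_ne_zero _ (denom_ne_zero g z)
  simp only [denom]
  fun_prop

section Bounds

variable {Γ : Subgroup (GL (Fin 2) ℝ)}

theorem continuous_of_mem_higherCuspForms {k : ℤ} {t : ℕ} {f : ℍ → ℂ}
    (hf : f ∈ higherCuspForms Γ k t) : Continuous f :=
  (mdifferentiable_of_mem_higherCuspForms hf).continuous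

/-- Integer translations are conjugated by `σ` to elements fixing the cusp, which fix `f`.
Periodicity extends bounds from a strip to all real parts. -/
theorem slash_scaling_upperRightHom_smul (hΓ : IsFuchsianFirstKind Γ) {t : ℕ} {f : ℍ → ℂ}
    (hf : f ∈ higherCuspForms Γ 2 t) {c : OnePoint ℝ} (hc : IsCusp c Γ) {σ : GL (Fin 2) ℝ}
    (hσ : IsScalingMatrix Γ c σ) (m : ℤ) (z : ℍ) :
    (f ∣[(2 : ℤ)] σ) (upperRightHom (m : ℝ) • z) = (f ∣[(2 : ℤ)] σ) z := by
  obtain ⟨h1, h2⟩ := hσ.conj_upperRightHom_mem m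
  have h3 : f ∣[(2 : ℤ)] (σ * upperRightHom (m : ℝ)) = f ∣[(2 : ℤ)] σ := by
    conv_rhs => rw [← slash_eq_of_smul_cusp_eq hΓ hf h1 hc h2, ← SlashAction.slash_mul]
    congr 1
    group
  conv_rhs => rw [← h3, SlashAction.slash_mul, slash_two_apply (by ext; simp [upperRightHom_apply])]
  simp [denom, upperRightHom_apply]

theorem exists_im_sq_mul_norm_slash_le (hΓ : IsFuchsianFirstKind Γ) {t : ℕ} {f : ℍ → ℂ}
    (hf : f ∈ higherCuspForms Γ 2 t) {c : OnePoint ℝ} (hc : IsCusp c Γ) {σ : GL (Fin 2) ℝ}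
    (hσ : IsScalingMatrix Γ c σ) :
    ∃ C : ℝ, ∀ z : ℍ, 1 ≤ z.im → z.im ^ 2 * ‖(f ∣[(2 : ℤ)] σ) z‖ ≤ C := by
  -- Raising the order by one makes the growth condition available for `t = 0` too.
  obtain ⟨a, ha, hO⟩ := (higherCuspForms_subset_succ t hf).2.2.2 c hc σ hσ
  obtain ⟨C, hC⟩ := exists_im_sq_mul_norm_le
    (continuous_slash_two hσ.det_eq_one (continuous_of_mem_higherCuspForms hf)) ha hO
  refine ⟨C, fun z hz => ?_⟩
  have hT := coe_upperRightHom_smul ((-⌊z.re⌋ : ℤ) : ℝ) z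
  have him : (upperRightHom ((-⌊z.re⌋ : ℤ) : ℝ) • z).im = z.im := by
    rw [← coe_im, hT]; simp
  have := hC (upperRightHom ((-⌊z.re⌋ : ℤ) : ℝ) • z) ?_ (by rwa [him])
  · rwa [him, slash_scaling_upperRightHom_smul hΓ hf hc hσ] at this
  · rw [← coe_re, hT]
    have h4 := Int.floor_le z.re
    have h5 := Int.lt_floor_add_one z.re
    constructor <;> simp <;> linarith

theorem exists_im_mul_norm_le_on_reduced (hΓ : IsFuchsianFirstKind Γ)
    {σ : OnePoint ℝ → GL (Fin 2) ℝ} (hσ : ∀ c, IsCusp c Γ → IsScalingMatrix Γ c (σ c))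
    {F K : Set ℍ} {R : Set (OnePoint ℝ)} (hK : IsCompact K) (hR : R.Finite)
    (hRc : ∀ c ∈ R, IsCusp c Γ)
    (hF : ∀ w ∈ F, w ∈ K ∨
      ∃ c ∈ R, ((σ c)⁻¹ • w).re ∈ Set.Icc (0 : ℝ) 1 ∧ 1 ≤ ((σ c)⁻¹ • w).im)
    {t : ℕ} {f : ℍ → ℂ} (hf : f ∈ higherCuspForms Γ 2 t) :
    ∃ C : ℝ, ∀ w ∈ F, w.im * ‖f w‖ ≤ C := by
  choose! C hC using fun c (hc : c ∈ R) =>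
    exists_im_sq_mul_norm_slash_le hΓ hf (hRc c hc) (hσ c (hRc c hc))
  obtain ⟨M, hM⟩ := (hR.image C).bddAbove
  obtain ⟨M', hM'⟩ := hK.bddAbove_image
    (continuous_im.mul (continuous_of_mem_higherCuspForms hf).norm).continuousOn
  refine ⟨max M M', fun w hw => ?_⟩
  rcases hF w hw with h | ⟨c, hc, -, h⟩
  · exact (hM' ⟨w, h, rfl⟩).trans (le_max_right _ _)
  · refine le_trans ?_ ((hM ⟨c, hc, rfl⟩).trans (le_max_left _ _))
    refine le_trans ?_ (hC c hc _ h)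
    have h1 := im_mul_norm_slash_two (hσ c (hRc c hc)).det_eq_one f ((σ c)⁻¹ • w)
    rw [smul_inv_smul] at h1
    rw [← h1, pow_two, mul_assoc]
    have h2 : 0 ≤ ((σ c)⁻¹ • w).im * ‖(f ∣[(2 : ℤ)] σ c) ((σ c)⁻¹ • w)‖ := by positivity
    nlinarith

open Pointwise in
/-- Word data for the group `Γ` and a fixed cusp with scaling matrix `σ`. -/
theorem exists_letters (hΓ : IsFuchsianFirstKind Γ) {c : OnePoint ℝ} (hc : IsCusp c Γ)
    {σ : GL (Fin 2) ℝ} (hσ : IsScalingMatrix Γ c σ) :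
    ∃ (S : Set (GL (Fin 2) ℝ)) (F : Set ℍ), S.Finite ∧ (∀ δ ∈ S, δ⁻¹ ∈ S) ∧
      (∀ z : ℍ, ∃ u ∈ letters Γ S ^ (⌈|Real.log (σ⁻¹ • z).im|⌉₊ + 1), u • z ∈ F) ∧
      (∀ w ∈ F, ∀ δ ∈ Γ.adjoinNegOne, δ • w ∈ F → δ ∈ letters Γ S) ∧
      ∀ t, ∀ f ∈ higherCuspForms Γ 2 t, ∃ C : ℝ, ∀ w ∈ F, w.im * ‖f w‖ ≤ C := by
  choose! τ hτ using fun c (hc : IsCusp c Γ) => exists_isScalingMatrix hΓ hc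
  -- The compact set put into `F` is the image under `σ` of the segment `[0, 1] + i`, where the
  -- walks start.
  obtain ⟨F, K, R, S, hKF, hS, hSinv, hred, hlet, hK, hR, hRc, hFK⟩ := exists_reduction hΓ hτ
    ((isCompact_setOf_re_im_mem_Icc (a := 1) (b := 1) (x := 0) (y := 1) one_pos).image
      (continuous_const_smul σ))
  refine ⟨S, F, hS, hSinv, fun z =>
    exists_mem_letters_pow_smul_mem hc hσ hKF hΓ.det_eq_one hred hlet z, ?_, fun t f hf =>
    exists_im_mul_norm_le_on_reduced hΓ hτ hK hR hRc hFK hf⟩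
  intro w hw δ hδ hδw
  exact ⟨hδ, hlet w hw _ hδw δ hδ (by simp)⟩

open Pointwise in
theorem exists_im_mul_norm_le (hΓ : IsFuchsianFirstKind Γ) {c : OnePoint ℝ} (hc : IsCusp c Γ)
    {σ : GL (Fin 2) ℝ} (hσ : IsScalingMatrix Γ c σ) {t : ℕ} {f : ℍ → ℂ}
    (hf : f ∈ higherCuspForms Γ 2 (t + 1)) :
    ∃ C : ℝ, 0 ≤ C ∧ ∀ z : ℍ, z.im * ‖f z‖ ≤ C * (1 + |Real.log (σ⁻¹ • z).im|) ^ t := by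
  obtain ⟨S, F, hS, hSinv, hu, -, hbd⟩ := exists_letters hΓ hc hσ
  obtain ⟨C, hC0, hC⟩ := exists_bound_slash_letters_pow hΓ hS
    (fun (w : F) (f : ℍ → ℂ) => w.1.im * ‖f w‖) (fun _ => 1) (fun _ => le_rfl) 0
    (fun w t f g _ _ => by
      rw [← mul_add]
      have := w.1.im_pos
      gcongr
      exact norm_add_le _ _)
    (fun t f hf => by
      obtain ⟨C, hC⟩ := hbd _ f hf
      exact ⟨C, fun w => by simpa using hC w w.2⟩) t f hf
  -- With `L` the absolute logarithm and `n = ⌈L⌉ + 1`, one has `1 + n ≤ L + 3 ≤ 3 (1 + L)`.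
  refine ⟨C * 3 ^ t, by positivity, fun z => ?_⟩
  obtain ⟨u, hu, huF⟩ := hu z
  have h1 := hC ⟨u • z, huF⟩ _ _ (letters_inv_pow hSinv hu)
  have hdet : u⁻¹.det = 1 := by
    rw [map_inv, hΓ.det_eq_one u (letters_pow_subset hu), inv_one]
  simp only [im_mul_norm_slash_two hdet, inv_smul_smul, add_zero] at h1
  refine h1.trans ?_
  rw [mul_assoc, ← mul_pow]
  have h2 := Nat.ceil_lt_add_one (abs_nonneg (Real.log (σ⁻¹ • z).im))
  have h3 := abs_nonneg (Real.log (σ⁻¹ • z).im)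
  gcongr
  push_cast
  linarith

end Bounds

end

noncomputable section

open ExtendedHalfPlane

/-! ### Primitives on the upper half plane -/

/-- `F` is a primitive of `f`. -/
def HasPrimitive (f F : ℍ → ℂ) : Prop :=
  ∀ z : ℍ, HasDerivAt (fun w : ℂ => F (ofComplex w)) (f z) z

/-- Holomorphic functions on a disc have primitives; the Cayley transform carries this to the half
plane. -/
theorem exists_hasPrimitive {f : ℍ → ℂ} (hf : MDiff f) : ∃ F, HasPrimitive f F := by
  let φ : ℂ → ℂ := fun u => Complex.I * (1 + u) / (1 - u)
  have hne {u : ℂ} (hu : u ∈ Metric.ball (0 : ℂ) 1) : 1 - u ≠ 0 := by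
    intro h
    rw [← sub_eq_zero.mp h] at hu
    simp at hu
  have hφ {u : ℂ} (hu : u ∈ Metric.ball (0 : ℂ) 1) :
      HasDerivAt φ (2 * Complex.I / (1 - u) ^ 2) u := by
    have h1 : HasDerivAt (fun u : ℂ => Complex.I * (1 + u)) Complex.I u := by
      simpa using ((hasDerivAt_id u).const_add 1).const_mul Complex.I
    have h2 : HasDerivAt (fun u : ℂ => 1 - u) (-1) u := by
      simpa using (hasDerivAt_id u).const_sub 1
    exact (h1.div h2 (hne hu)).congr_deriv (by ring)
  have him {u : ℂ} (hu : u ∈ Metric.ball (0 : ℂ) 1) : 0 < (φ u).im := by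
    have h0 : 0 < Complex.normSq (1 - u) := Complex.normSq_pos.mpr (hne hu)
    have h1 : Complex.normSq u < 1 := by
      rw [Complex.normSq_eq_norm_sq]
      rw [mem_ball_zero_iff] at hu
      nlinarith [norm_nonneg u]
    have : (φ u).im = (1 - Complex.normSq u) / Complex.normSq (1 - u) := by
      simp only [φ, Complex.div_im, Complex.mul_im, Complex.mul_re, Complex.I_re, Complex.I_im,
        Complex.add_re, Complex.add_im, Complex.sub_re, Complex.sub_im, Complex.one_re,
        Complex.one_im, Complex.normSq_apply]
      ring
    rw [this]
    exact div_pos (by linarith) h0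
  have hdiff : DifferentiableOn ℂ (fun u => f (ofComplex (φ u)) * (2 * Complex.I / (1 - u) ^ 2))
      (Metric.ball 0 1) := by
    intro u hu
    have h1 : DifferentiableAt ℂ (f ∘ ofComplex) (φ u) :=
      ((UpperHalfPlane.mdifferentiable_iff.mp hf) _ (him hu)).differentiableAt
        (isOpen_upperHalfPlaneSet.mem_nhds (him hu))
    have h2 : DifferentiableAt ℂ (fun u => (f ∘ ofComplex) (φ u)) u :=
      h1.comp u (hφ hu).differentiableAt
    have h3 : DifferentiableAt ℂ (fun u : ℂ => 2 * Complex.I / (1 - u) ^ 2) u := by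
      refine DifferentiableAt.div (by fun_prop) (by fun_prop) (pow_ne_zero _ (hne hu))
    exact (h2.mul h3).differentiableWithinAt
  obtain ⟨P, hP⟩ := hdiff.isExactOn_ball
  let ψ : ℂ → ℂ := fun z => (z - Complex.I) / (z + Complex.I)
  refine ⟨fun z => P (ψ z), fun z => ?_⟩
  have hzI : (z : ℂ) + Complex.I ≠ 0 := by
    intro h
    have h1 := congrArg Complex.im h
    have := z.im_pos
    simp at h1
    linarith
  have h1ψ : 1 - ψ z = 2 * Complex.I / (z + Complex.I) := by
    simp only [ψ]; field_simp; ring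
  have hball : ψ z ∈ Metric.ball (0 : ℂ) 1 := by
    rw [mem_ball_zero_iff, norm_div, div_lt_one (norm_pos_iff.mpr hzI), ← sq_lt_sq₀ (norm_nonneg _)
      (norm_nonneg _), ← Complex.normSq_eq_norm_sq, ← Complex.normSq_eq_norm_sq]
    simp only [Complex.normSq_apply, Complex.sub_re, Complex.sub_im, Complex.add_re, Complex.add_im,
      Complex.I_re, Complex.I_im, coe_re, coe_im]
    nlinarith [z.im_pos]
  have hφψ : φ (ψ z) = z := by
    have h2 : 1 + ψ z = 2 * z / (z + Complex.I) := by
      simp only [ψ]; field_simp; ring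
    simp only [φ]
    rw [h1ψ, h2]
    field_simp [Complex.I_ne_zero]
  have hψ : HasDerivAt ψ (2 * Complex.I / (z + Complex.I) ^ 2) z := by
    have h1 : HasDerivAt (fun w : ℂ => w - Complex.I) 1 (z : ℂ) := (hasDerivAt_id _).sub_const _
    have h2 : HasDerivAt (fun w : ℂ => w + Complex.I) 1 (z : ℂ) := (hasDerivAt_id _).add_const _
    exact (h1.div h2 hzI).congr_deriv (by ring)
  have hcomp := (hP (ψ z) hball).comp (z : ℂ) hψ
  have hval : f (ofComplex (φ (ψ z))) * (2 * Complex.I / (1 - ψ z) ^ 2) *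
      (2 * Complex.I / (z + Complex.I) ^ 2) = f z := by
    rw [hφψ, ofComplex_apply, h1ψ, mul_assoc]
    have : 2 * Complex.I / (2 * Complex.I / (z + Complex.I)) ^ 2 *
        (2 * Complex.I / (z + Complex.I) ^ 2) = 1 := by
      field_simp [Complex.I_ne_zero]
    rw [this, mul_one]
  rw [hval] at hcomp
  refine hcomp.congr_of_eventuallyEq ?_
  filter_upwards [isOpen_upperHalfPlaneSet.mem_nhds z.im_pos] with w hw
  simp only [Function.comp_apply]
  rw [ofComplex_apply_of_im_pos hw]

namespace HasPrimitive

variable {f g F G : ℍ → ℂ}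

theorem hasDerivAt (h : HasPrimitive f F) {w : ℂ} (hw : 0 < w.im) :
    HasDerivAt (fun w : ℂ => F (ofComplex w)) (f (ofComplex w)) w := by
  rw [ofComplex_apply_of_im_pos hw]
  exact h ⟨w, hw⟩

theorem add (hf : HasPrimitive f F) (hg : HasPrimitive g G) : HasPrimitive (f + g) (F + G) :=
  fun z => (hf z).add (hg z)

/-- Chain rule: the derivative of `g` is `(cz + d)⁻²`, exactly the weight two factor. -/
theorem slash_two (h : HasPrimitive f F) {g : GL (Fin 2) ℝ} (hg : g.det = 1) :
    HasPrimitive (f ∣[(2 : ℤ)] g) fun z => F (g • z) := by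
  intro z
  have hd : g.val.det = 1 := by simpa [Units.ext_iff] using hg
  have h1 := (hasStrictDerivAt_smul (g := g) (by rw [hd]; exact one_pos) z).hasDerivAt
  have h2 : HasDerivAt (fun w : ℂ => F (ofComplex w)) (f (g • z)) ((g • ofComplex (z : ℂ) : ℍ) : ℂ) := by
    rw [ofComplex_apply]; exact h (g • z)
  have h3 := h2.comp (z : ℂ) h1
  rw [slash_two_apply hg]
  refine (h3.congr_deriv ?_).congr_of_eventuallyEq (Eventually.of_forall fun w => ?_)
  · rw [hd]; simp [div_eq_mul_inv]
  · simp

theorem segmentIntegral_eq (h : HasPrimitive f F) (hf : Continuous f) (z w : ℍ) :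
    segmentIntegral f z w = F w - F z := by
  have him {s : ℝ} (hs : s ∈ Set.uIcc (0 : ℝ) 1) : 0 < ((z : ℂ) + s * ((w : ℂ) - z)).im := by
    rw [Set.uIcc_of_le zero_le_one] at hs
    have h1 : ((z : ℂ) + s * ((w : ℂ) - z)).im = (1 - s) * z.im + s * w.im := by
      simp; ring
    rw [h1]
    have := z.im_pos
    have := w.im_pos
    rcases hs.2.lt_or_eq with h | h
    · have := mul_pos (sub_pos.mpr h) z.im_pos
      have := mul_nonneg hs.1 w.im_pos.le
      linarith
    · rw [h]; linarith
  have hline (s : ℝ) : HasDerivAt (fun s : ℝ => (z : ℂ) + s * ((w : ℂ) - z)) ((w : ℂ) - z) s := by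
    simpa using ((hasDerivAt_id s).ofReal_comp.mul_const ((w : ℂ) - z)).const_add (z : ℂ)
  have key := intervalIntegral.integral_eq_sub_of_hasDerivAt (a := 0) (b := 1)
    (f := fun s : ℝ => F (ofComplex ((z : ℂ) + s * ((w : ℂ) - z))))
    (f' := fun s : ℝ => ((w : ℂ) - z) * f (ofComplex ((z : ℂ) + s * ((w : ℂ) - z)))) ?_ ?_
  · rw [segmentIntegral, key]
    simp [ofComplex_apply]
  · intro s hs
    exact (h.hasDerivAt (him hs)).scomp s (hline s)
  · refine ContinuousOn.intervalIntegrable fun s hs => ContinuousAt.continuousWithinAt ?_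
    have h1 : ContinuousAt (fun s : ℝ => (z : ℂ) + s * ((w : ℂ) - z)) s := (hline s).continuousAt
    have h2 : ContinuousAt (ofComplex : ℂ → ℍ) ((z : ℂ) + s * ((w : ℂ) - z)) :=
      (mdifferentiableAt_ofComplex (him hs)).continuousAt
    have h3 : ContinuousAt (fun s : ℝ => ofComplex ((z : ℂ) + s * ((w : ℂ) - z))) s :=
      ContinuousAt.comp (f := fun s : ℝ => (z : ℂ) + s * ((w : ℂ) - z)) h2 h1
    exact continuousAt_const.mul (hf.continuousAt.comp h3)

theorem hasDerivAt_vertical (h : HasPrimitive f F) (x : ℝ) {y : ℝ} (hy : 0 < y) :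
    HasDerivAt (fun y : ℝ => F (ofComplex (x + y * Complex.I)))
      (Complex.I * f (ofComplex (x + y * Complex.I))) y := by
  have h1 : HasDerivAt (fun y : ℝ => (x : ℂ) + y * Complex.I) Complex.I y := by
    simpa using ((hasDerivAt_id y).ofReal_comp.mul_const Complex.I).const_add (x : ℂ)
  exact (h.hasDerivAt (w := x + y * Complex.I) (by simpa using hy)).scomp y h1

/-- In the variable `u = 1 / y` the hypothesis says that the derivative of `G` is bounded by `C` on
`(0, 1]`. -/
theorem norm_sub_vertical_le (h : HasPrimitive g G) {C : ℝ}
    (hC : ∀ z : ℍ, 1 ≤ z.im → z.im ^ 2 * ‖g z‖ ≤ C) (x : ℝ) {y y' : ℝ} (hy : 1 ≤ y)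
    (hy' : 1 ≤ y') : ‖G (ofComplex (x + y * Complex.I)) - G (ofComplex (x + y' * Complex.I))‖ ≤
      C * |y⁻¹ - y'⁻¹| := by
  have hmem {y : ℝ} (hy : 1 ≤ y) : y⁻¹ ∈ Set.Ioc (0 : ℝ) 1 :=
    ⟨inv_pos.mpr (by linarith), inv_le_one_of_one_le₀ hy⟩
  have key := (convex_Ioc (0 : ℝ) 1).norm_image_sub_le_of_norm_hasDerivWithin_le (C := C)
    (f := fun u : ℝ => G (ofComplex (x + (u⁻¹ : ℝ) * Complex.I)))
    (f' := fun u : ℝ => (-(u ^ 2)⁻¹) •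
      (Complex.I * g (ofComplex (x + (u⁻¹ : ℝ) * Complex.I)))) ?_ ?_ (hmem hy') (hmem hy)
  · simpa only [inv_inv, Real.norm_eq_abs] using key
  · intro u hu
    exact ((h.hasDerivAt_vertical x (inv_pos.mpr hu.1)).scomp u
      (hasDerivAt_inv hu.1.ne')).hasDerivWithinAt
  · intro u hu
    have hu1 : 1 ≤ u⁻¹ := (one_le_inv₀ hu.1).mpr hu.2
    have hpos : 0 < ((x : ℂ) + (u⁻¹ : ℝ) * Complex.I).im := by simpa using hu.1
    have him : (ofComplex ((x : ℂ) + (u⁻¹ : ℝ) * Complex.I)).im = u⁻¹ := by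
      rw [ofComplex_apply_of_im_pos hpos, ← coe_im]; simp
    have := hC (ofComplex ((x : ℂ) + (u⁻¹ : ℝ) * Complex.I)) (by rwa [him])
    rw [him] at this
    rw [norm_smul, norm_mul, Complex.norm_I, one_mul, norm_neg, norm_inv, norm_pow,
      Real.norm_of_nonneg hu.1.le, ← inv_pow]
    exact this

theorem norm_sub_horizontal_le (h : HasPrimitive g G) {C : ℝ}
    (hC : ∀ z : ℍ, 1 ≤ z.im → z.im ^ 2 * ‖g z‖ ≤ C) (x : ℝ) {y : ℝ} (hy : 1 ≤ y) :
    ‖G (ofComplex (x + y * Complex.I)) - G (ofComplex ((0 : ℝ) + y * Complex.I))‖ ≤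
      C / y ^ 2 * |x| := by
  have hpos (s : ℝ) : 0 < ((s : ℂ) + y * Complex.I).im := by simp; linarith
  have key := (convex_univ (𝕜 := ℝ) (E := ℝ)).norm_image_sub_le_of_norm_hasDerivWithin_le
    (C := C / y ^ 2) (f := fun s : ℝ => G (ofComplex (s + y * Complex.I)))
    (f' := fun s : ℝ => g (ofComplex (s + y * Complex.I))) ?_ ?_ (Set.mem_univ 0) (Set.mem_univ x)
  · simpa using key
  · intro s _
    have h1 : HasDerivAt (fun s : ℝ => (s : ℂ) + y * Complex.I) 1 s := by
      simpa using (hasDerivAt_id s).ofReal_comp.add_const (y * Complex.I : ℂ)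
    have h2 : HasDerivAt (fun s : ℝ => G (ofComplex (s + y * Complex.I)))
        (g (ofComplex (s + y * Complex.I))) s :=
      (HasDerivAt.scomp s (h.hasDerivAt (hpos s)) h1).congr_deriv (one_smul ℂ _)
    exact h2.hasDerivWithinAt
  · intro s _
    have him : (ofComplex ((s : ℂ) + y * Complex.I)).im = y := by
      rw [ofComplex_apply_of_im_pos (hpos s), ← coe_im]; simp
    have := hC (ofComplex ((s : ℂ) + y * Complex.I)) (by rwa [him])
    rw [him] at this
    rw [le_div_iff₀ (by positivity)]
    linarith

/-- The Lipschitz bound in `1 / y` gives a Cauchy family on each vertical line; the horizontal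
bound, of size `y⁻²`, makes the limits agree. -/
theorem exists_tendsto_vertical (h : HasPrimitive g G) {C : ℝ}
    (hC : ∀ z : ℍ, 1 ≤ z.im → z.im ^ 2 * ‖g z‖ ≤ C) :
    ∃ l : ℂ, (∀ x : ℝ, Tendsto (fun y : ℝ => G (ofComplex (x + y * Complex.I))) atTop (𝓝 l)) ∧
      ∀ z : ℍ, 1 ≤ z.im → ‖G z - l‖ ≤ C := by
  have hC0 : 0 ≤ C := le_trans (by positivity) (hC UpperHalfPlane.I (by simp))
  have hinv {y y' : ℝ} (hy : 1 ≤ y) (hyy : y ≤ y') : |y'⁻¹ - y⁻¹| ≤ y⁻¹ := by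
    have h1 : y'⁻¹ ≤ y⁻¹ := inv_anti₀ (by linarith) hyy
    have h2 : 0 ≤ y'⁻¹ := inv_nonneg.mpr (by linarith)
    rw [abs_le]
    constructor <;> linarith
  have hlim (x : ℝ) : ∃ l : ℂ,
      Tendsto (fun y : ℝ => G (ofComplex (x + y * Complex.I))) atTop (𝓝 l) := by
    refine cauchySeq_tendsto_of_complete (Metric.cauchySeq_iff'.mpr fun ε hε => ?_)
    refine ⟨C / ε + 1, fun y hy => ?_⟩
    have h1 : 1 ≤ C / ε + 1 := by have := div_nonneg hC0 hε.le; linarith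
    rw [dist_eq_norm]
    refine (h.norm_sub_vertical_le hC x (h1.trans hy) h1).trans_lt ?_
    refine (mul_le_mul_of_nonneg_left (hinv h1 hy) hC0).trans_lt ?_
    rw [← div_eq_mul_inv, div_lt_iff₀ (by linarith)]
    have : ε * (C / ε + 1) = C + ε := by field_simp
    linarith
  choose l hl using hlim
  have hl0 (x : ℝ) : l x = l 0 := by
    have h1 := (hl x).sub (hl 0)
    have h2 : Tendsto (fun y : ℝ => C / y ^ 2 * |x|) atTop (𝓝 0) := by
      have : Tendsto (fun y : ℝ => C / y ^ 2) atTop (𝓝 0) :=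
        tendsto_const_nhds.div_atTop (tendsto_pow_atTop two_ne_zero)
      simpa using this.mul_const |x|
    have h3 := squeeze_zero_norm' (f := fun y : ℝ => G (ofComplex (x + y * Complex.I)) -
      G (ofComplex ((0 : ℝ) + y * Complex.I))) ?_ h2
    · exact sub_eq_zero.mp (tendsto_nhds_unique h1 h3)
    · filter_upwards [eventually_ge_atTop 1] with y hy
      exact h.norm_sub_horizontal_le hC x hy
  refine ⟨l 0, fun x => hl0 x ▸ hl x, fun z hz => ?_⟩
  rw [← hl0 z.re]
  have hz0 : G (ofComplex ((z.re : ℝ) + z.im * Complex.I)) = G z := by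
    congr 1
    conv_rhs => rw [← ofComplex_apply z]
    congr 1
    exact Complex.re_add_im z
  have h1 : Tendsto (fun y : ℝ => ‖G z - G (ofComplex (z.re + y * Complex.I))‖) atTop
      (𝓝 ‖G z - l z.re‖) := (tendsto_const_nhds.sub (hl z.re)).norm
  refine le_of_tendsto h1 ?_
  filter_upwards [eventually_ge_atTop z.im] with y hy
  rw [norm_sub_rev, ← hz0]
  refine (h.norm_sub_vertical_le hC z.re (hz.trans hy) hz).trans ?_
  have h3 := hinv hz hy
  have h4 := inv_le_one_of_one_le₀ hz
  nlinarith

end HasPrimitive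

end

noncomputable section

open ExtendedHalfPlane

/-! ### Limits of primitives at cusps -/

theorem im_add_mul_I (x y : ℝ) : ((x : ℂ) + y * Complex.I).im = y := by simp

theorem exists_smul_mul_I_eq {g : GL (Fin 2) ℝ} (hg : g.det = 1) (h : g 1 0 = 0) :
    ∃ x β : ℝ, 0 < β ∧ ∀ y : ℝ, 0 < y →
      g • ofComplex (y * Complex.I) = ofComplex (x + (β * y : ℝ) * Complex.I) := by
  have hd : g 0 0 * g 1 1 = 1 := by
    have := det_entries_eq_one hg
    rw [h] at this
    linarith
  have ha : g 0 0 ≠ 0 := left_ne_zero_of_mul_eq_one hd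
  have hd' : g 1 1 = (g 0 0)⁻¹ := eq_inv_of_mul_eq_one_right hd
  refine ⟨g 0 0 * g 0 1, g 0 0 ^ 2, by positivity, fun y hy => ?_⟩
  have hy1 : 0 < ((y : ℂ) * Complex.I).im := by simpa using hy
  have hy2 : 0 < (((g 0 0 * g 0 1 : ℝ) : ℂ) + (g 0 0 ^ 2 * y : ℝ) * Complex.I).im := by
    rw [im_add_mul_I]
    positivity
  ext1
  have hdet : 0 < (g.det : ℝ) := by rw [hg]; simp
  rw [coe_smul_of_det_pos hdet, ofComplex_apply_of_im_pos hy1, ofComplex_apply_of_im_pos hy2]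
  simp only [num, denom, h, hd']
  have : ((g 0 0 : ℝ) : ℂ) ≠ 0 := by exact_mod_cast ha
  push_cast
  field_simp
  ring

theorem exists_geodesicTo_eq (c : OnePoint ℝ) :
    ∃ g : GL (Fin 2) ℝ, g.det = 1 ∧ g • (OnePoint.infty : OnePoint ℝ) = c ∧
      ∀ y : ℝ, 0 < y → geodesicTo c y = g • ofComplex (y * Complex.I) := by
  cases c using OnePoint.rec with
  | infty => exact ⟨1, by simp, by simp, fun y _ => by rw [one_smul]; rfl⟩
  | coe x =>
    have hdet : (!![x, -1; 1, 0] : Matrix (Fin 2) (Fin 2) ℝ).det = 1 := by simp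
    let g : GL (Fin 2) ℝ := GeneralLinearGroup.mkOfDetNeZero !![x, -1; 1, 0] (by rw [hdet]; simp)
    have hg : g.det = 1 := by ext; simp [g, GeneralLinearGroup.mkOfDetNeZero]
    refine ⟨g, hg, ?_, fun y hy => ?_⟩
    · rw [OnePoint.smul_infty_eq_ite]
      simp [g, GeneralLinearGroup.mkOfDetNeZero]
    · have hy1 : 0 < ((y : ℂ) * Complex.I).im := by simpa using hy
      have hy2 : 0 < ((x : ℂ) + ((1 / y : ℝ) : ℂ) * Complex.I).im := by simpa using hy
      have hpos : 0 < (g.det : ℝ) := by rw [hg]; simp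
      change ofComplex ((x : ℂ) + ((1 / y : ℝ) : ℂ) * Complex.I) = _
      ext1
      rw [coe_smul_of_det_pos hpos, ofComplex_apply_of_im_pos hy1, ofComplex_apply_of_im_pos hy2]
      have : (y : ℂ) ≠ 0 := by exact_mod_cast hy.ne'
      simp only [num, denom, g, GeneralLinearGroup.mkOfDetNeZero]
      simp
      field_simp
      linear_combination Complex.I_sq

variable {Γ : Subgroup (GL (Fin 2) ℝ)}

namespace HasPrimitive

variable {f F : ℍ → ℂ} {t : ℕ}

/-- Any `g` with `g ∞ = c` differs from `σ` by a matrix fixing `∞`, which maps the imaginary axis to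
a vertical line. Hence all geodesics into the cusp give the same limit. -/
theorem exists_tendsto_smul_mul_I (h : HasPrimitive f F) (hΓ : IsFuchsianFirstKind Γ)
    (hf : f ∈ higherCuspForms Γ 2 t) {c : OnePoint ℝ} (hc : IsCusp c Γ) :
    ∃ l : ℂ, ∀ g : GL (Fin 2) ℝ, g.det = 1 → g • (OnePoint.infty : OnePoint ℝ) = c →
      Tendsto (fun y : ℝ => F (g • ofComplex (y * Complex.I))) atTop (𝓝 l) := by
  obtain ⟨σ, hσ⟩ := exists_isScalingMatrix hΓ hc
  obtain ⟨C, hC⟩ := exists_im_sq_mul_norm_slash_le hΓ hf hc hσ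
  obtain ⟨l, hl, -⟩ := (h.slash_two hσ.det_eq_one).exists_tendsto_vertical hC
  refine ⟨l, fun g hg hgc => ?_⟩
  have hdet : (σ⁻¹ * g).det = 1 := by rw [map_mul, map_inv, hσ.det_eq_one, hg]; simp
  have hfix : (σ⁻¹ * g) 1 0 = 0 := by
    rw [← OnePoint.smul_infty_eq_self_iff, mul_smul, hgc, inv_smul_eq_iff, hσ.smul_infty]
  obtain ⟨x, β, hβ, hx⟩ := exists_smul_mul_I_eq hdet hfix
  refine ((hl x).comp (tendsto_id.const_mul_atTop hβ)).congr' ?_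
  filter_upwards [eventually_gt_atTop 0] with y hy
  simp only [Function.comp_apply, id]
  rw [← hx y hy, mul_smul, smul_inv_smul]

/-- `κ` extends the primitive to `ℍ*`. The last clause is needed because `γ` need not map the
standard path to `p` onto the standard path to `γ p`. -/
theorem exists_tendsto_pathTo (h : HasPrimitive f F) (hΓ : IsFuchsianFirstKind Γ)
    (hf : f ∈ higherCuspForms Γ 2 t) :
    ∃ κ : ExtendedHalfPlane Γ → ℂ, (∀ z, κ (ofPoint z) = F z) ∧
      (∀ p, Tendsto (fun y => F (pathTo p y)) atTop (𝓝 (κ p))) ∧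
      ∀ p, ∀ γ : Γ, Tendsto (fun y => F (γ • pathTo p y)) atTop (𝓝 (κ (γ • p))) := by
  choose l hl using fun c : cuspsSubMulAction Γ => h.exists_tendsto_smul_mul_I hΓ hf c.2
  have key : ∀ c : cuspsSubMulAction Γ, ∀ γ : Γ, Tendsto
      (fun y => F (γ • geodesicTo c y)) atTop (𝓝 (l (γ • c))) := by
    intro c γ
    obtain ⟨g, hg, hgc, hgy⟩ := exists_geodesicTo_eq (c : OnePoint ℝ)
    have := hΓ.hasDetOne
    refine (hl (γ • c) (γ * g) ?_ ?_).congr' ?_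
    · rw [map_mul, hg, mul_one]
      exact Subgroup.HasDetOne.det_eq γ.2
    · rw [mul_smul, hgc]
      rfl
    · filter_upwards [eventually_gt_atTop 0] with y hy
      rw [hgy y hy, mul_smul]
      rfl
  refine ⟨Sum.elim F l, fun _ => rfl, ?_, ?_⟩
  · rintro (z | c)
    · exact tendsto_const_nhds
    · simpa using! key c 1
  · rintro (z | c) γ
    · exact tendsto_const_nhds
    · exact key c γ

theorem hasPathIntegral (h : HasPrimitive f F) (hf : Continuous f) {p q : ExtendedHalfPlane Γ}
    {a b : ℂ} (hp : Tendsto (fun y => F (pathTo p y)) atTop (𝓝 a))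
    (hq : Tendsto (fun y => F (pathTo q y)) atTop (𝓝 b)) : HasPathIntegral f p q (b - a) :=
  (hq.sub hp).congr fun _ => (h.segmentIntegral_eq hf _ _).symm

theorem exists_norm_sub_le (h : HasPrimitive f F) (hΓ : IsFuchsianFirstKind Γ) {c : OnePoint ℝ}
    (hc : IsCusp c Γ) {σ : GL (Fin 2) ℝ} (hσ : IsScalingMatrix Γ c σ)
    (hf : f ∈ higherCuspForms Γ 2 (t + 1)) (κ : ℂ) :
    ∃ C : ℝ, 0 ≤ C ∧ ∀ z : ℍ, ‖F z - κ‖ ≤ C * (1 + |Real.log (σ⁻¹ • z).im|) ^ (t + 1) := by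
  obtain ⟨C₀, hC₀⟩ := exists_im_sq_mul_norm_slash_le hΓ hf hc hσ
  obtain ⟨C₁, hC₁0, hC₁⟩ := exists_im_mul_norm_le hΓ hc hσ hf
  have hG := h.slash_two hσ.det_eq_one
  obtain ⟨l, -, hl⟩ := hG.exists_tendsto_vertical hC₀
  have hC₀0 : 0 ≤ C₀ := le_trans (by positivity) (hC₀ UpperHalfPlane.I (by simp))
  have hup (v : ℍ) (hv : 1 ≤ v.im) : ‖F (σ • v) - l‖ ≤ C₀ := hl v hv
  have hdown (v : ℍ) : ‖F (σ • v) - l‖ ≤ (C₀ + C₁) * (1 + |Real.log v.im|) ^ (t + 1) := by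
    set L := |Real.log v.im| with hL
    have hL0 : 0 ≤ L := abs_nonneg _
    have hpow : 1 ≤ (1 + L) ^ (t + 1) := one_le_pow₀ (by linarith)
    rcases le_total 1 v.im with hv | hv
    · exact (hup v hv).trans (by nlinarith)
    have hpos (u : ℝ) : 0 < ((v.re : ℂ) + (Real.exp u : ℝ) * Complex.I).im := by
      rw [im_add_mul_I]
      exact Real.exp_pos u
    have him (u : ℝ) : (ofComplex ((v.re : ℂ) + (Real.exp u : ℝ) * Complex.I)).im = Real.exp u := by
      rw [ofComplex_apply_of_im_pos (hpos u), ← coe_im]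
      exact im_add_mul_I _ _
    have hlog : Real.log v.im ≤ 0 := Real.log_nonpos v.im_pos.le hv
    -- Mean value inequality in `u = log y`: the derivative is `y` times the form, which the
    -- pointwise bound controls, over an interval of length `L`.
    have key := (convex_Icc (Real.log v.im) 0).norm_image_sub_le_of_norm_hasDerivWithin_le
      (C := C₁ * (1 + L) ^ t)
      (f := fun u : ℝ => F (σ • ofComplex ((v.re : ℂ) + (Real.exp u : ℝ) * Complex.I)))
      (f' := fun u : ℝ => Real.exp u • (Complex.I * (f ∣[(2 : ℤ)] σ)
        (ofComplex ((v.re : ℂ) + (Real.exp u : ℝ) * Complex.I)))) ?_ ?_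
      (Set.right_mem_Icc.mpr hlog) (Set.left_mem_Icc.mpr hlog)
    · have hv0 : ofComplex ((v.re : ℂ) + (Real.exp (Real.log v.im) : ℝ) * Complex.I) = v := by
        rw [Real.exp_log v.im_pos]
        conv_rhs => rw [← ofComplex_apply v]
        congr 1
        exact Complex.re_add_im v
      rw [hv0, sub_zero, Real.norm_eq_abs, ← hL, mul_assoc] at key
      have h1 := hup (ofComplex ((v.re : ℂ) + (Real.exp 0 : ℝ) * Complex.I)) (by rw [him]; simp)
      have h2 : L * (1 + L) ^ t ≤ (1 + L) ^ (t + 1) := by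
        rw [pow_succ, mul_comm]
        exact mul_le_mul_of_nonneg_left (by linarith) (by positivity)
      rw [mul_comm _ L] at key
      have h3 := norm_add_le _ _ |>.trans (add_le_add key h1)
      rw [sub_add_sub_cancel] at h3
      refine h3.trans ?_
      nlinarith [mul_le_mul_of_nonneg_left h2 hC₁0]
    · intro u _
      exact ((hG.hasDerivAt_vertical v.re (Real.exp_pos u)).scomp u
        (Real.hasDerivAt_exp u)).hasDerivWithinAt
    · intro u hu
      set w := ofComplex ((v.re : ℂ) + (Real.exp u : ℝ) * Complex.I) with hw
      have h1 := hC₁ (σ • w)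
      rw [← im_mul_norm_slash_two hσ.det_eq_one, inv_smul_smul, him, Real.log_exp] at h1
      rw [norm_smul, norm_mul, Complex.norm_I, one_mul, Real.norm_of_nonneg (Real.exp_pos u).le]
      refine h1.trans ?_
      have h2 : |u| ≤ L := by
        rw [hL, abs_of_nonpos hu.2, abs_of_nonpos hlog]
        linarith [hu.1]
      gcongr
  refine ⟨C₀ + C₁ + ‖l - κ‖, by positivity, fun z => ?_⟩
  have h1 := hdown (σ⁻¹ • z)
  rw [smul_inv_smul] at h1
  have hpow : 1 ≤ (1 + |Real.log (σ⁻¹ • z).im|) ^ (t + 1) :=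
    one_le_pow₀ (by linarith [abs_nonneg (Real.log (σ⁻¹ • z).im)])
  calc ‖F z - κ‖ = ‖(F z - l) + (l - κ)‖ := by rw [sub_add_sub_cancel]
    _ ≤ (C₀ + C₁) * (1 + |Real.log (σ⁻¹ • z).im|) ^ (t + 1) + ‖l - κ‖ :=
      (norm_add_le _ _).trans (by linarith)
    _ ≤ _ := by nlinarith [norm_nonneg (l - κ)]

end HasPrimitive

end

noncomputable section

open ExtendedHalfPlane

/-! ### Growth of primitives and periods -/

variable {Γ : Subgroup (GL (Fin 2) ℝ)}

open Pointwise in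
/-- An element of `Γ` is a word in the letters, of length bounded in terms of the heights of a
point and its image. -/
theorem exists_mem_letters_pow {S : Set (GL (Fin 2) ℝ)} {F : Set ℍ} {σ : GL (Fin 2) ℝ}
    (hSinv : ∀ δ ∈ S, δ⁻¹ ∈ S)
    (hu : ∀ z : ℍ, ∃ u ∈ letters Γ S ^ (⌈|Real.log (σ⁻¹ • z).im|⌉₊ + 1), u • z ∈ F)
    (hF : ∀ w ∈ F, ∀ δ ∈ Γ.adjoinNegOne, δ • w ∈ F → δ ∈ letters Γ S) (z : ℍ)
    {γ : GL (Fin 2) ℝ} (hγ : γ ∈ Γ.adjoinNegOne) :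
    ∃ n : ℕ, γ ∈ letters Γ S ^ n ∧
      (n : ℝ) ≤ |Real.log (σ⁻¹ • z).im| + |Real.log (σ⁻¹ • γ • z).im| + 5 := by
  obtain ⟨u, hu1, huF⟩ := hu z
  obtain ⟨v, hv1, hvF⟩ := hu (γ • z)
  -- This element maps `u z` to `v γ z`, both in `F`, so it is a single letter between the words
  -- `v⁻¹` and `u`.
  have hδ : v * γ * u⁻¹ ∈ Γ.adjoinNegOne :=
    mul_mem (mul_mem (letters_pow_subset hv1) hγ) (inv_mem (letters_pow_subset hu1))
  have hδ' : v * γ * u⁻¹ ∈ letters Γ S :=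
    hF _ huF _ hδ (by rw [mul_smul, mul_smul, inv_smul_smul]; exact hvF)
  refine ⟨(⌈|Real.log (σ⁻¹ • γ • z).im|⌉₊ + 1) + 1 + (⌈|Real.log (σ⁻¹ • z).im|⌉₊ + 1), ?_, ?_⟩
  · have hmem := Set.mul_mem_mul (Set.mul_mem_mul (letters_inv_pow hSinv hv1) hδ') hu1
    have h : v⁻¹ * (v * γ * u⁻¹) * u = γ := by group
    rwa [h, ← pow_succ, ← pow_add] at hmem
  · have h1 := Nat.ceil_lt_add_one (abs_nonneg (Real.log (σ⁻¹ • z).im))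
    have h2 := Nat.ceil_lt_add_one (abs_nonneg (Real.log (σ⁻¹ • γ • z).im))
    push_cast
    linarith

theorem exists_norm_pathIntegral_le (hΓ : IsFuchsianFirstKind Γ) {c : OnePoint ℝ}
    (hc : IsCusp c Γ) {σ : GL (Fin 2) ℝ} (hσ : IsScalingMatrix Γ c σ) {t : ℕ} {f : ℍ → ℂ}
    (hf : f ∈ higherCuspForms Γ 2 (t + 1)) (z₀ : ExtendedHalfPlane Γ) :
    ∃ C : ℝ, 0 ≤ C ∧ ∀ z : ℍ, HasPathIntegral f z₀ (ofPoint z) (pathIntegral f z₀ (ofPoint z)) ∧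
      ‖pathIntegral f z₀ (ofPoint z)‖ ≤ C * (1 + |Real.log (σ⁻¹ • z).im|) ^ (t + 1) := by
  obtain ⟨F, hF⟩ := exists_hasPrimitive (mdifferentiable_of_mem_higherCuspForms hf)
  obtain ⟨κ, hκ0, hκ, -⟩ := hF.exists_tendsto_pathTo hΓ hf
  obtain ⟨C, hC0, hC⟩ := hF.exists_norm_sub_le hΓ hc hσ hf (κ z₀)
  refine ⟨C, hC0, fun z => ?_⟩
  have h := hF.hasPathIntegral (continuous_of_mem_higherCuspForms hf) (hκ z₀) (hκ (ofPoint z))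
  rw [hκ0] at h
  rw [h.pathIntegral_eq]
  exact ⟨h, hC z⟩

theorem HasPathIntegral.add {f g : ℍ → ℂ} (hf : MDiff f) (hg : MDiff g)
    {p q : ExtendedHalfPlane Γ} {a b : ℂ} (h : HasPathIntegral f p q a)
    (h' : HasPathIntegral g p q b) : HasPathIntegral (f + g) p q (a + b) := by
  obtain ⟨F, hF⟩ := exists_hasPrimitive hf
  obtain ⟨G, hG⟩ := exists_hasPrimitive hg
  refine (Tendsto.add h h').congr fun y => ?_
  rw [hF.segmentIntegral_eq hf.continuous, hG.segmentIntegral_eq hg.continuous,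
    (hF.add hG).segmentIntegral_eq (hf.continuous.add hg.continuous)]
  simp only [Pi.add_apply]
  ring

open Pointwise in
-- The auxiliary point `z` splits the period at `γ z`; the piece from `γ z₀` to `γ z` is an integral
-- of `f|γ` from `z₀` to `z`, bounded by writing `γ` as a word.
theorem exists_norm_pathIntegral_smul_le (hΓ : IsFuchsianFirstKind Γ) {c : OnePoint ℝ}
    (hc : IsCusp c Γ) {σ : GL (Fin 2) ℝ} (hσ : IsScalingMatrix Γ c σ) {t : ℕ} {f : ℍ → ℂ}
    (hf : f ∈ higherCuspForms Γ 2 (t + 1)) (z₀ : ExtendedHalfPlane Γ) :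
    ∃ C : ℝ, 0 ≤ C ∧ ∀ z : ℍ, ∀ γ : Γ, ∃ v : ℂ, HasPathIntegral f z₀ (γ • z₀) v ∧
      ‖v‖ ≤ C * (1 + |Real.log (σ⁻¹ • z).im| + |Real.log (σ⁻¹ • γ • z).im|) ^ (t + 1) := by
  obtain ⟨S, D, hS, hSinv, hu, hD, -⟩ := exists_letters hΓ hc hσ
  obtain ⟨F, hF⟩ := exists_hasPrimitive (mdifferentiable_of_mem_higherCuspForms hf)
  obtain ⟨κ, hκ0, hκ, hκγ⟩ := hF.exists_tendsto_pathTo hΓ hf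
  obtain ⟨C₁, hC₁0, hC₁⟩ := hF.exists_norm_sub_le hΓ hc hσ hf (κ z₀)
  -- The shift is `e = 1` because integrals carry one more logarithm than values.
  obtain ⟨C₂, hC₂0, hC₂⟩ := exists_bound_slash_letters_pow hΓ hS
    (fun (z : ℍ) f => ‖pathIntegral f z₀ (ofPoint z)‖) (fun z => 1 + |Real.log (σ⁻¹ • z).im|)
    (fun z => by linarith [abs_nonneg (Real.log (σ⁻¹ • z).im)]) 1
    (fun z t f g hf hg => by
      obtain ⟨_, _, hf'⟩ := exists_norm_pathIntegral_le hΓ hc hσ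
        (higherCuspForms_subset_succ t hf) z₀
      obtain ⟨_, _, hg'⟩ := exists_norm_pathIntegral_le hΓ hc hσ
        (higherCuspForms_subset_succ t hg) z₀
      have h := HasPathIntegral.add (mdifferentiable_of_mem_higherCuspForms hf)
        (mdifferentiable_of_mem_higherCuspForms hg) (hf' z).1 (hg' z).1
      rw [h.pathIntegral_eq]
      exact norm_add_le _ _)
    (fun t f hf => by
      obtain ⟨C, -, hC⟩ := exists_norm_pathIntegral_le hΓ hc hσ hf z₀
      exact ⟨C, fun z => (hC z).2⟩) t f hf
  -- The `6` comes from `1 + a + n ≤ 6 + 2a + b ≤ 6 (1 + a + b)`, with `a`, `b` the absolute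
  -- logarithms of the two heights.
  refine ⟨C₂ * 6 ^ (t + 1) + C₁, by positivity, fun z γ => ⟨κ (γ • z₀) - κ z₀,
    hF.hasPathIntegral (continuous_of_mem_higherCuspForms hf) (hκ _) (hκ _), ?_⟩⟩
  have hγ : (γ : GL (Fin 2) ℝ) ∈ Γ.adjoinNegOne := .inl γ.2
  obtain ⟨n, hn, hnle⟩ := exists_mem_letters_pow hSinv hu hD z hγ
  have hdet := hΓ.det_eq_one _ hγ
  have hprim := hF.slash_two hdet
  have hint : HasPathIntegral (f ∣[(2 : ℤ)] (γ : GL (Fin 2) ℝ)) z₀ (ofPoint z)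
      (F (γ • z) - κ (γ • z₀)) :=
    hprim.hasPathIntegral (continuous_slash_two hdet (continuous_of_mem_higherCuspForms hf))
      (hκγ z₀ γ) (tendsto_const_nhds (x := F (γ • z)))
  have h1 : ‖F (γ • z) - κ (γ • z₀)‖ ≤ C₂ * (1 + |Real.log (σ⁻¹ • z).im| + n) ^ (t + 1) := by
    have := hC₂ z n γ hn
    rwa [hint.pathIntegral_eq] at this
  have h2 : ‖F (γ • z) - κ z₀‖ ≤ C₁ * (1 + |Real.log (σ⁻¹ • γ • z).im|) ^ (t + 1) := hC₁ (γ • z)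
  have ha := abs_nonneg (Real.log (σ⁻¹ • z).im)
  have hb := abs_nonneg (Real.log (σ⁻¹ • γ • z).im)
  change (n : ℝ) ≤ |Real.log (σ⁻¹ • z).im| + |Real.log (σ⁻¹ • γ • z).im| + 5 at hnle
  set a := |Real.log (σ⁻¹ • z).im|
  set b := |Real.log (σ⁻¹ • γ • z).im|
  calc ‖κ (γ • z₀) - κ z₀‖ = ‖(F (γ • z) - κ z₀) - (F (γ • z) - κ (γ • z₀))‖ := by
        congr 1; ring
    _ ≤ C₁ * (1 + b) ^ (t + 1) + C₂ * (1 + a + n) ^ (t + 1) :=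
        (norm_sub_le _ _).trans (add_le_add h2 h1)
    _ ≤ C₁ * (1 + a + b) ^ (t + 1) + C₂ * (6 * (1 + a + b)) ^ (t + 1) := by
        gcongr
        · linarith
        · linarith
    _ = _ := by rw [mul_pow]; ring

/-! ### Comparison with sums of powers -/

theorem pow_one_add_le_sum {a : ℝ} (ha : 0 ≤ a) (t : ℕ) :
    (1 + a) ^ t ≤ 2 ^ t * ∑ i ∈ Finset.range (t + 1), a ^ i := by
  rw [add_comm, add_pow, Finset.mul_sum]
  refine Finset.sum_le_sum fun i hi => ?_
  rw [one_pow, mul_one, mul_comm]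
  gcongr
  have := Nat.choose_le_two_pow t i
  exact_mod_cast this

theorem pow_one_add_add_le_sum {a b : ℝ} (ha : 0 ≤ a) (hb : 0 ≤ b) (t : ℕ) :
    (1 + a + b) ^ t ≤ 3 ^ t * ∑ p ∈ Finset.range (t + 1) ×ˢ Finset.range (t + 1) with
      p.1 + p.2 ≤ t, a ^ p.1 * b ^ p.2 := by
  set s := ∑ p ∈ Finset.range (t + 1) ×ˢ Finset.range (t + 1) with p.1 + p.2 ≤ t, a ^ p.1 * b ^ p.2
  have hle (i j : ℕ) (hij : i + j ≤ t) : a ^ i * b ^ j ≤ s :=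
    Finset.single_le_sum (f := fun p : ℕ × ℕ => a ^ p.1 * b ^ p.2) (fun p _ => by positivity)
      (a := (i, j)) (by simp; omega)
  -- The power of the largest of `1`, `a`, `b` is itself one of the monomials in the sum.
  have hmax : max 1 (max a b) ^ t ≤ s := by
    rcases max_choice 1 (max a b) with h | h
    · simpa [h] using hle 0 0 (by omega)
    rcases max_choice a b with h' | h'
    · rw [h, h']
      simpa using hle t 0 (by omega)
    · rw [h, h']
      simpa using hle 0 t (by omega)
  calc (1 + a + b) ^ t ≤ (3 * max 1 (max a b)) ^ t := by
        gcongr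
        have := le_max_left 1 (max a b)
        have := le_max_right 1 (max a b)
        linarith [le_max_left a b, le_max_right a b]
    _ ≤ 3 ^ t * s := by
        rw [mul_pow]
        gcongr

theorem abs_log_mul_le {k y : ℝ} (hk : 0 < k) (hy : 0 < y) :
    1 + |Real.log (k * y)| ≤ (1 + |Real.log k|) * (1 + |Real.log y|) := by
  rw [Real.log_mul hk.ne' hy.ne']
  nlinarith [abs_add_le (Real.log k) (Real.log y),
    mul_nonneg (abs_nonneg (Real.log k)) (abs_nonneg (Real.log y))]

/-- A matrix fixing `∞` scales imaginary parts by a constant. -/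
theorem exists_im_smul_eq_mul {g : GL (Fin 2) ℝ} (hg : g.det = 1) (h : g 1 0 = 0) :
    ∃ k : ℝ, 0 < k ∧ ∀ z : ℍ, (g • z).im = k * z.im := by
  have hd : g 0 0 * g 1 1 = 1 := by
    have := det_entries_eq_one hg
    rw [h] at this
    linarith
  have hd' : g 1 1 ≠ 0 := right_ne_zero_of_mul_eq_one hd
  refine ⟨(g 1 1 * g 1 1)⁻¹, inv_pos.mpr (mul_self_pos.mpr hd'), fun z => ?_⟩
  rw [im_smul_eq_div_normSq, hg]
  simp [denom, h, Complex.normSq_ofReal]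
  ring

end

theorem lemma2p1 (Γ : Subgroup (GL (Fin 2) ℝ)) (hΓ : IsFuchsianFirstKind Γ)
    (hcusps : Nontrivial (CuspOrbits Γ)) (t : ℕ) (f : ℍ → ℂ)
    (hf : f ∈ higherCuspForms Γ 2 t) (hfH : slashDiff Γ f ∈ calH Γ t) :
    -- (i) in the coordinate `z`, when `∞` is a cusp
    (IsCusp OnePoint.infty Γ →
      ∃ C : ℝ, ∀ z : ℍ,
        z.im * ‖f z‖ ≤ C * ∑ i ∈ Finset.range t, |Real.log z.im| ^ i) ∧
    ∀ c : OnePoint ℝ, IsCusp c Γ → ∀ σ : GL (Fin 2) ℝ, IsScalingMatrix Γ c σ →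
      -- (i) in the coordinate of an arbitrary cusp
      (∃ C : ℝ, ∀ z : ℍ,
        z.im * ‖f z‖ ≤ C * ∑ i ∈ Finset.range t, |Real.log (σ⁻¹ • z).im| ^ i) ∧
      ∀ z₀ : ExtendedHalfPlane Γ,
        -- (ii)
        (∃ C : ℝ, ∀ z : ℍ, ∃ v : ℂ,
          HasPathIntegral f z₀ (ExtendedHalfPlane.ofPoint z) v ∧
          ‖v‖ ≤ C * ∑ j ∈ Finset.range (t + 1), |Real.log (σ⁻¹ • z).im| ^ j) ∧
        -- (iii)
        (∃ C : ℝ, ∀ z : ℍ, ∀ γ : Γ, ∃ v : ℂ,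
          HasPathIntegral f z₀ (γ • z₀) v ∧
          ‖v‖ ≤ C * ∑ p ∈ Finset.range (t + 1) ×ˢ Finset.range (t + 1) with p.1 + p.2 ≤ t,
            |Real.log (σ⁻¹ • z).im| ^ p.1 * |Real.log (σ⁻¹ • (γ • z)).im| ^ p.2) := by

  cases t with
  | zero =>
    obtain rfl : f = 0 := hf
    have h0 (p q : ExtendedHalfPlane Γ) : HasPathIntegral (0 : ℍ → ℂ) p q 0 := by
      simp [HasPathIntegral, segmentIntegral]
    refine ⟨fun _ => ⟨0, fun z => by simp⟩, fun c _ σ _ => ⟨⟨0, fun z => by simp⟩, fun z₀ =>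
      ⟨⟨0, fun z => ⟨0, h0 _ _, by simp⟩⟩, ⟨0, fun z γ => ⟨0, h0 _ _, by simp⟩⟩⟩⟩⟩
  | succ t =>
    refine ⟨fun hc => ?_, fun c hc σ hσ => ⟨?_, fun z₀ => ⟨?_, ?_⟩⟩⟩
    · obtain ⟨σ, hσ⟩ := exists_isScalingMatrix hΓ hc
      obtain ⟨C, hC0, hC⟩ := exists_im_mul_norm_le hΓ hc hσ hf
      -- At the cusp `∞` the scaling matrix only multiplies heights by a constant, which changes `1
      -- + |log|` by at most a constant factor.
      obtain ⟨k, hk, hkz⟩ := exists_im_smul_eq_mul (g := σ⁻¹)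
        (by rw [map_inv, hσ.det_eq_one, inv_one])
        (by rw [← OnePoint.smul_infty_eq_self_iff, inv_smul_eq_iff, hσ.smul_infty])
      refine ⟨C * (1 + |Real.log k|) ^ t * 2 ^ t, fun z => (hC z).trans ?_⟩
      rw [hkz, mul_assoc, mul_assoc]
      refine mul_le_mul_of_nonneg_left ?_ hC0
      refine (pow_le_pow_left₀ (by positivity) (abs_log_mul_le hk z.im_pos) t).trans ?_
      rw [mul_pow]
      exact mul_le_mul_of_nonneg_left (pow_one_add_le_sum (abs_nonneg _) t) (by positivity)
    · obtain ⟨C, hC0, hC⟩ := exists_im_mul_norm_le hΓ hc hσ hf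
      refine ⟨C * 2 ^ t, fun z => (hC z).trans ?_⟩
      rw [mul_assoc]
      exact mul_le_mul_of_nonneg_left (pow_one_add_le_sum (abs_nonneg _) t) hC0
    · obtain ⟨C, hC0, hC⟩ := exists_norm_pathIntegral_le hΓ hc hσ hf z₀
      refine ⟨C * 2 ^ (t + 1), fun z => ⟨_, (hC z).1, (hC z).2.trans ?_⟩⟩
      rw [mul_assoc]
      exact mul_le_mul_of_nonneg_left (pow_one_add_le_sum (abs_nonneg _) _) hC0
    · obtain ⟨C, hC0, hC⟩ := exists_norm_pathIntegral_smul_le hΓ hc hσ hf z₀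
      refine ⟨C * 3 ^ (t + 1), fun z γ => ?_⟩
      obtain ⟨v, hv, hvC⟩ := hC z γ
      refine ⟨v, hv, hvC.trans ?_⟩
      rw [mul_assoc]
      exact mul_le_mul_of_nonneg_left
        (pow_one_add_add_le_sum (abs_nonneg _) (abs_nonneg _) _) hC0
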